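/- Let the real sequences $(p_k)_{k\ge 0}$, $(q_k)_{k\ge 1}$, $(r_k)_{k\ge 0}$ satisfy $r_0>q_1>r_1>q_2>r_2>\cdots>0$, $q_k,r_k\to 0$, $p_0>p_1>p_2>\cdots>0$, $p_0<r_0$, and $p_k>r_k$ for $k\ge 1$. Let $T:[0,r_0]\to\mathbb R$ be the "saw map": $T(0)=0$, $T(q_k)=0$ for $k\ge 1$, $T(r_k)=p_k$ for $k\ge 0$, and $T$ is affine on $[q_{k+1},r_k]$ for each $k\ge 0$ and on $[r_k,q_k]$ for each $k\ge 1$. For $k\ge1$ let $e_k$ be the unique fixed point of $T$ in $(q_{k+1},r_k)$ and $\hat e_k$ the unique fixed point in $(r_k,q_k)$. Put $\alpha_k=p_k/(r_k-q_{k+1})$ for $k\ge 0$ and $\beta_k=p_k/(q_k-r_k)$ for $k\ge 1$. Assume that $(\alpha_k)_{k\ge1}$ and $(\beta_k)_{k\ge1}$ are (not necessarily strictly) increasing, and that there is $k^*\ge 1$ with $p_k>e_{k-1}$ for $k\ge k^*+1$, $p_k<e_{k-1}$ for $2\le k\le k^*$, and $q_k+e_k/\alpha_{k-1}>p_k$ for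 $1\le k\le k^*-1$. For $1\le k\le k^*$ let $J_k=[e_k,p_k]$ and $G_k=[T(p_k),p_k]$. A set $A$ is invariant if $T(A)=A$. A closed invariant set $A$ is chaotic if the periodic points of $T$ lying in $A$ are dense in $A$, $T$ has sensitive dependence on initial conditions on $A$ (there is $\delta>0$ such that for all $x\in A$ and $\varepsilon>0$ there are $y\in A$ with $|x-y|<\varepsilon$ and $n\ge0$ with $|T^n(x)-T^n(y)|>\delta$), and some orbit starting in $A$ is dense in $A$. Stability means Lyapunov stability with respect to $T$ on $[0,r_0]$. Let $1\le k\le k^*$. (1) If $\beta_k<1$, then $J_k$ is invariant, $\hat e_k\in J_k$ is a stable fixed point, and $T^n(x)\to\hat e_k$ for every $x\in J_k\setminus\{e_k\}$. (2) If $\beta_k>1$ and $\alpha_k^{-1}+\beta_k^{-1}>1$, then $J_k$ is invariant, and $G_k\subsetneq J_k$ is invariant. There are an integer $N\ge 0$ and nonempty bounded open intervals $A_1,\dots,A_{2^N}$ with pairwise disjoint closures such that $\Lambda_k=\bigcup_{i=1}^{2^N}\overline{A_i}\subseteq G_k$ is a chaotic invariant set and the following holds. (a) $T(\overline{A_i})=\overline{A_{i+1}}$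 for $1\le i<2^N$, and $T(\overline{A_{2^N}})=\overline{A_1}$. The interval $A_{\sigma^{i}_{2^N}}$ lies to the left of $A_{\sigma^{i+1}_{2^N}}$ for $1\le i<2^N$, where $\sigma_{2^N}$ is the permutation of $\{1,\dots,2^N\}$ defined by $\sigma^1_1=1$ and, for $1\le i\le 2^M$, $M\ge0$, $$\sigma^{2^M+i}_{2^{M+1}}=2\sigma^i_{2^M}-1,\qquad \sigma^i_{2^{M+1}}=\sigma^{2^{M+1}+1-i}_{2^{M+1}}+1 .$$ (b) $G_k\setminus\Lambda_k$ contains $N$ unstable periodic orbits $O_1,\dots,O_N$, where $O_i$ has minimal period $2^{i-1}$. (c) For every $x\in G_k\setminus(\Lambda_k\cup O_1\cup\dots\cup O_N)$ whose trajectory does not hit $O_2\cup\dots\cup O_N$ there is $n_0$ such that $T^n(x)\in\Lambda_k$ for all $n\ge n_0$. Moreover, for every $y\in J_k\setminus(G_k\cup\{e_k\})$ there is $n_1$ such that $T^n(y)\in G_k$ for all $n\ge n_1$. (3) If $\alpha_k^{-1}+\beta_k^{-1}<1$ and $k\le k^*-1$, then $J_k$ contains a chaotic invariant Cantor set $\Lambda_k$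 on which $T$ is topologically conjugate to the left shift on $\{0,1\}^{\mathbb N}$, and for every $x\in J_k\setminus\Lambda_k$ there is $n_2$ such that $T^n(x)\in[0,e_k)$ for all $n\ge n_2$. -/

import Mathlib

open Set Filter Topology

noncomputable section

namespace Saw

/-- The conditions on the three sequences `p k` (`k ≥ 0`), `q k` (`k ≥ 1`), `r k` (`k ≥ 0`);
the value `q 0` is never used:
`r 0 > q 1 > r 1 > q 2 > r 2 > ⋯ > 0`, `q k, r k → 0`, `p 0 > p 1 > ⋯ > 0`, `p 0 < r 0` and
`p k > r k` for `k ≥ 1`. -/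
structure IsSawSeq (p q r : ℕ → ℝ) : Prop where
  q_lt_r : ∀ k, q (k + 1) < r k
  r_lt_q : ∀ k, 1 ≤ k → r k < q k
  q_pos : ∀ k, 1 ≤ k → 0 < q k
  r_pos : ∀ k, 0 < r k
  q_tendsto : Tendsto q atTop (𝓝 0)
  r_tendsto : Tendsto r atTop (𝓝 0)
  p_anti : ∀ k, p (k + 1) < p k
  p_pos : ∀ k, 0 < p k
  p_zero_lt : p 0 < r 0
  r_lt_p : ∀ k, 1 ≤ k → r k < p k

/-- `T` is given on the segment `[a, b]` by an affine formula. -/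
def IsLinearOn (T : ℝ → ℝ) (a b : ℝ) : Prop :=
  ∃ m c : ℝ, ∀ x ∈ Icc a b, T x = m * x + c

/-- `T` is the saw map on `[0, r 0]` with parameters `p, q, r`. This determines the values of
`T` on `[0, r 0]`; the values elsewhere play no role. -/
structure IsSawMap (p q r : ℕ → ℝ) (T : ℝ → ℝ) : Prop where
  map_zero : T 0 = 0
  map_q : ∀ k, 1 ≤ k → T (q k) = 0
  map_r : ∀ k, T (r k) = p k
  linear_left : ∀ k, IsLinearOn T (q (k + 1)) (r k)
  linear_right : ∀ k, 1 ≤ k → IsLinearOn T (r k) (q k)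

/-- The absolute value of the slope of `T` on `[q (k+1), r k]`. -/
def alpha (p q r : ℕ → ℝ) (k : ℕ) : ℝ := p k / (r k - q (k + 1))

/-- The absolute value of the slope of `T` on `[r k, q k]`, `k ≥ 1`. -/
def beta (p q r : ℕ → ℝ) (k : ℕ) : ℝ := p k / (q k - r k)

/-- An affine function that is below the diagonal at one end of a segment and above it at the
other end has exactly one fixed point in the interior. -/
theorem existsUnique_fixed {T : ℝ → ℝ} {a b : ℝ} (hab : a < b) (hT : IsLinearOn T a b)
    (h : (T a - a) * (T b - b) < 0) : ∃! x, x ∈ Ioo a b ∧ T x = x := by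
  obtain ⟨m, c, hmc⟩ := hT
  rw [hmc a (left_mem_Icc.2 hab.le), hmc b (right_mem_Icc.2 hab.le)] at h
  have hm : m - 1 ≠ 0 := by
    intro h0
    have : m = 1 := by linarith
    subst this
    nlinarith [sq_nonneg c]
  have key : ∀ x, m * x + c - x = (m - 1) * (x - c / (1 - m)) := by
    intro x
    have : (1 : ℝ) - m ≠ 0 := fun h0 => hm (by linarith)
    field_simp
    ring
  have h2 : (a - c / (1 - m)) * (b - c / (1 - m)) < 0 := by
    rw [key a, key b] at h
    have hpos : 0 < (m - 1) ^ 2 := by positivity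
    by_contra hcon
    push Not at hcon
    nlinarith [mul_nonneg hpos.le hcon]
  have hin : c / (1 - m) ∈ Ioo a b := by
    constructor <;> by_contra hcon <;> push Not at hcon <;> nlinarith
  refine ⟨c / (1 - m), ⟨hin, ?_⟩, ?_⟩
  · rw [hmc _ (Ioo_subset_Icc_self hin)]
    have := key (c / (1 - m))
    simp only [sub_self, mul_zero] at this
    linarith
  · rintro y ⟨hy, hTy⟩
    rw [hmc _ (Ioo_subset_Icc_self hy)] at hTy
    have h3 := key y
    rw [hTy, sub_self] at h3
    rcases mul_eq_zero.1 h3.symm with h4 | h4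
    · exact absurd h4 hm
    · linarith

/-- The fixed point of `T` in `(q (k+1), r k)`, `k ≥ 1`. -/
def e (T : ℝ → ℝ) (q r : ℕ → ℝ) (k : ℕ) : ℝ :=
  Classical.epsilon fun x => x ∈ Ioo (q (k + 1)) (r k) ∧ T x = x

/-- The fixed point of `T` in `(r k, q k)`, `k ≥ 1`. -/
def eHat (T : ℝ → ℝ) (q r : ℕ → ℝ) (k : ℕ) : ℝ :=
  Classical.epsilon fun x => x ∈ Ioo (r k) (q k) ∧ T x = x

section
variable {p q r : ℕ → ℝ} {T : ℝ → ℝ}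

theorem existsUnique_e (hs : IsSawSeq p q r) (hT : IsSawMap p q r T) {k : ℕ} (hk : 1 ≤ k) :
    ∃! x, x ∈ Ioo (q (k + 1)) (r k) ∧ T x = x := by
  refine existsUnique_fixed (hs.q_lt_r k) (hT.linear_left k) ?_
  rw [hT.map_q (k + 1) (by omega), hT.map_r k]
  have h1 := hs.q_pos (k + 1) (by omega)
  have h2 := hs.r_lt_p k hk
  nlinarith

theorem existsUnique_eHat (hs : IsSawSeq p q r) (hT : IsSawMap p q r T) {k : ℕ} (hk : 1 ≤ k) :
    ∃! x, x ∈ Ioo (r k) (q k) ∧ T x = x := by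
  refine existsUnique_fixed (hs.r_lt_q k hk) (hT.linear_right k hk) ?_
  rw [hT.map_q k hk, hT.map_r k]
  have h1 := hs.q_pos k hk
  have h2 := hs.r_lt_p k hk
  nlinarith

theorem e_spec (hs : IsSawSeq p q r) (hT : IsSawMap p q r T) {k : ℕ} (hk : 1 ≤ k) :
    e T q r k ∈ Ioo (q (k + 1)) (r k) ∧ T (e T q r k) = e T q r k :=
  Classical.epsilon_spec (existsUnique_e hs hT hk).exists

theorem eHat_spec (hs : IsSawSeq p q r) (hT : IsSawMap p q r T) {k : ℕ} (hk : 1 ≤ k) :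
    eHat T q r k ∈ Ioo (r k) (q k) ∧ T (eHat T q r k) = eHat T q r k :=
  Classical.epsilon_spec (existsUnique_eHat hs hT hk).exists

end

/-- The standing assumptions on the saw map and on the number `kstar ≥ 1`: the slopes `α k`,
`β k` increase; `p k > e (k-1)` for `k ≥ kstar + 1`, `p k < e (k-1)` for `2 ≤ k ≤ kstar`; and
`q k + e k / α (k-1) > p k` for `1 ≤ k ≤ kstar - 1`. -/
structure StandingAssumptions (p q r : ℕ → ℝ) (T : ℝ → ℝ) (kstar : ℕ) : Prop where
  alpha_mono : ∀ k, 1 ≤ k → alpha p q r k ≤ alpha p q r (k + 1)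
  beta_mono : ∀ k, 1 ≤ k → beta p q r k ≤ beta p q r (k + 1)
  one_le : 1 ≤ kstar
  p_gt : ∀ k, kstar + 1 ≤ k → e T q r (k - 1) < p k
  p_lt : ∀ k, 2 ≤ k → k ≤ kstar → p k < e T q r (k - 1)
  technical : ∀ k, 1 ≤ k → k + 1 ≤ kstar →
    p k < q k + e T q r k / alpha p q r (k - 1)

/-- The segment `J k = [e k, p k]`. -/
def J (p q r : ℕ → ℝ) (T : ℝ → ℝ) (k : ℕ) : Set ℝ := Icc (e T q r k) (p k)

/-- The segment `G k = [T (p k), p k]`. -/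
def G (p : ℕ → ℝ) (T : ℝ → ℝ) (k : ℕ) : Set ℝ := Icc (T (p k)) (p k)

/-- Invariance of a set, `f(A) = A` (in particular `f(A) ⊆ A`). -/
def IsInvariant (f : ℝ → ℝ) (A : Set ℝ) : Prop := f '' A = A

/-- The forward orbit of a point. -/
def orbit (f : ℝ → ℝ) (x : ℝ) : Set ℝ := range fun n : ℕ => f^[n] x

/-- A chaotic invariant set in the sense of Devaney. -/
structure IsChaotic (f : ℝ → ℝ) (A : Set ℝ) : Prop where
  closed : IsClosed A
  invariant : IsInvariant f A
  dense_periodic : A ⊆ closure (A ∩ Function.periodicPts f)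
  sensitive : ∃ δ > 0, ∀ x ∈ A, ∀ ε > 0, ∃ y ∈ A, |x - y| < ε ∧
    ∃ n : ℕ, δ < |f^[n] x - f^[n] y|
  dense_orbit : ∃ x ∈ A, A ⊆ closure (orbit f x)

/-- A Cantor set on the line. -/
structure IsCantorSet (A : Set ℝ) : Prop where
  nonempty : A.Nonempty
  compact : IsCompact A
  perfect : Perfect A
  totallyDisconnected : IsTotallyDisconnected A

/-- The left shift on the space of one-sided sequences of two symbols. -/
def shift (s : ℕ → Bool) : ℕ → Bool := fun n => s (n + 1)

/-- The restriction of `f` to `A` is topologically conjugate to the left shift on the space of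
one-sided sequences of two symbols. -/
def ConjugateToShift (f : ℝ → ℝ) (A : Set ℝ) : Prop :=
  ∃ (hf : MapsTo f A A) (h : A ≃ₜ (ℕ → Bool)), ∀ x : A, h (hf.restrict f A A x) = shift (h x)

/-- Lyapunov stability of a set `O` (a fixed point, a periodic orbit) for the map `f` of the
phase space `X`. -/
def IsStable (X : Set ℝ) (f : ℝ → ℝ) (O : Set ℝ) : Prop :=
  ∀ ε > 0, ∃ δ > 0, ∀ x ∈ X, Metric.infDist x O < δ → ∀ n : ℕ, Metric.infDist (f^[n] x) O < ε

/-- The permutations `σ_N` of `{1, …, 2^N}` (values outside this range play no role). -/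
def sigma : ℕ → ℕ → ℕ
  | 0, _ => 1
  | N + 1, j => if 2 ^ N < j then 2 * sigma N (j - 2 ^ N) - 1 else 2 * sigma N (2 ^ N + 1 - j)

theorem sigma_pos (N : ℕ) : ∀ i, 1 ≤ i → i ≤ 2 ^ N → 1 ≤ sigma N i := by
  induction N with
  | zero => intro i _ _; simp [sigma]
  | succ N ih =>
    intro i h1 h2
    rw [pow_succ] at h2
    simp only [sigma]
    split_ifs with h
    · have := ih (i - 2 ^ N) (by omega) (by omega); omega
    · have := ih (2 ^ N + 1 - i) (by omega) (by omega); omega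

/-- The recursive formulas
`σ_{N+1}(2^N + i) = 2 σ_N(i) - 1`, `σ_{N+1}(i) = σ_{N+1}(2^{N+1} + 1 - i) + 1`. -/
theorem sigma_rec (N i : ℕ) (h1 : 1 ≤ i) (h2 : i ≤ 2 ^ N) :
    sigma (N + 1) (2 ^ N + i) = 2 * sigma N i - 1 ∧
      sigma (N + 1) i = sigma (N + 1) (2 ^ (N + 1) + 1 - i) + 1 := by
  have h3 : 2 ^ (N + 1) + 1 - i = 2 ^ N + (2 ^ N + 1 - i) := by rw [pow_succ]; omega
  have h4 := sigma_pos N (2 ^ N + 1 - i) (by omega) (by omega)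
  rw [h3]
  refine ⟨?_, ?_⟩
  · simp only [sigma]
    rw [if_pos (by omega), Nat.add_sub_cancel_left]
  · simp only [sigma]
    rw [if_neg (by omega), if_pos (by omega), Nat.add_sub_cancel_left]
    omega

end Saw

end

namespace Saw

/-! ### General facts on iteration of maps of the line -/

/-! On `[q (k+1), q k]` the saw map is a skew tent map f with slopes a = α_k and -b = -β_k and peak
(r, r + h), where r = r_k and h = p_k - r_k. The fixed point e on its left branch repels with factor
a > 1, so points of J_k other than e climb away from it, and everything depends on what happens near
the peak.

If b < 1, the segment [r, r + h] is mapped into itself and contracted towards the right fixed point.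

If b > 1 and ab < a + b, the image of the top r + h is still above e, and every point of J_k other
than e falls into the core [r + h - bh, r + h]. Let z be the fixed point on the decreasing branch.
When a + b ≤ ab², the second image of the top is at most z, and expansion forces the images of any
segment to cover the core (`TentParam.iUnion_image_eq_core`); dense orbits, dense periodic points
and sensitivity follow (`TentParam.isChaotic_core`). When ab² < a + b, the core contains two
segments interchanged by f and separated by a gap around z. On the left one f², with the line
reversed, is again a skew tent map, now with slopes b² and -ab (`TentParam.flipSq_tent`). A cycle of
2^N intervals for it yields one of 2^(N+1) intervals for f, with z as a new repelling orbit
(`Swap.intervalCycle_double`). The slope b grows by a definite factor at each renormalization, so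
after finitely many of them the first alternative holds (`exists_intervalCycle_aux`).

If a + b < ab, the top is mapped below e. With c the point of the right branch that is mapped to e,
two disjoint subsegments of [e, c] are each stretched over [e, c]; the points that never leave form
a Cantor set coded by itineraries (`Horseshoe`). All other points fall below e_k and cannot return,
since the next peak p_(k+1) is lower than e_k. -/

theorem exists_dense_orbit {f : ℝ → ℝ} (hf : Continuous f) {Λ : Set ℝ} (hc : IsClosed Λ)
    (hne : Λ.Nonempty) (hm : MapsTo f Λ Λ)
    (htr : ∀ x ∈ Λ, ∀ y ∈ Λ, ∀ ε > 0, ∃ z ∈ Λ, |z - x| < ε ∧ ∃ n : ℕ, |f^[n] z - y| < ε) :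
    ∃ x ∈ Λ, Λ ⊆ closure (orbit f x) := by
  have : CompleteSpace Λ := hc.completeSpace_coe
  have : Nonempty Λ := hne.to_subtype
  -- Baire category: for each B in a countable basis of Λ, the set `U B` of points whose orbit meets
  -- B is open, and dense by `htr`. A point common to all these sets has a dense orbit.
  let U : Set Λ → Set Λ := fun B => {x | ∃ n : ℕ, (hm.iterate n).restrict _ _ _ x ∈ B}
  have ho : ∀ B ∈ TopologicalSpace.countableBasis Λ, IsOpen (U B) := by
    intro B hB
    have hUB : U B = ⋃ n : ℕ, (hm.iterate n).restrict _ _ _ ⁻¹' B := by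
      ext x; simp [U]
    rw [hUB]
    refine isOpen_iUnion fun n => (TopologicalSpace.isOpen_of_mem_countableBasis hB).preimage ?_
    exact (hf.iterate n).continuousOn.mapsToRestrict (hm.iterate n)
  have hd : ∀ B ∈ TopologicalSpace.countableBasis Λ, Dense (U B) := by
    intro B hB
    obtain ⟨y, hy⟩ := TopologicalSpace.nonempty_of_mem_countableBasis hB
    obtain ⟨η, hη, hball⟩ :=
      Metric.isOpen_iff.1 (TopologicalSpace.isOpen_of_mem_countableBasis hB) y hy
    intro x
    rw [Metric.mem_closure_iff]
    intro ε hε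
    obtain ⟨z, hz, hzx, n, hn⟩ := htr x x.2 y y.2 (min ε η) (lt_min hε hη)
    refine ⟨⟨z, hz⟩, ⟨n, hball ?_⟩, ?_⟩
    · rw [Metric.mem_ball, Subtype.dist_eq, Real.dist_eq]
      exact hn.trans_le (min_le_right _ _)
    · rw [dist_comm, Subtype.dist_eq, Real.dist_eq]
      exact hzx.trans_le (min_le_left _ _)
  obtain ⟨x, hx⟩ := (dense_biInter_of_isOpen ho (TopologicalSpace.countable_countableBasis Λ)
    hd).nonempty
  refine ⟨x, x.2, fun y hy => ?_⟩
  rw [Metric.mem_closure_iff]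
  intro ε hε
  obtain ⟨B, hB, hyB, hBs⟩ := (TopologicalSpace.isBasis_countableBasis Λ).exists_subset_of_mem_open
    (show (⟨y, hy⟩ : Λ) ∈ Metric.ball (⟨y, hy⟩ : Λ) ε from Metric.mem_ball_self hε)
    Metric.isOpen_ball
  obtain ⟨n, hn⟩ := mem_iInter₂.1 hx B hB
  refine ⟨f^[n] x, ⟨n, rfl⟩, ?_⟩
  have := hBs hn
  rw [Metric.mem_ball, dist_comm, Subtype.dist_eq] at this
  exact this

/-- Without periodic points in the segment, the direction in which f^m moves y persists under its
powers: at the first failure some iterate would move y and f^m y in opposite senses, and have a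
fixed point between them. -/
theorem lt_iterate_of_no_periodic {f : ℝ → ℝ} (hf : Continuous f) {u v : ℝ}
    (hno : ∀ x ∈ Icc u v, x ∉ Function.periodicPts f) {m : ℕ} (hm : 0 < m) {y : ℝ} (huy : u ≤ y)
    (hy : y < f^[m] y) (hyv : f^[m] y ≤ v) (k : ℕ) : y < f^[m * (k + 1)] y := by
  induction k with
  | zero => simpa using hy
  | succ k ih =>
    by_contra hcon
    push Not at hcon
    have h1 : f^[m * (k + 1)] (f^[m] y) ≤ f^[m] y := by
      rw [← Function.iterate_add_apply]
      exact hcon.trans hy.le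
    -- the displacement of the iterate changes sign on `[y, f^[m] y]`
    obtain ⟨x, hx, hxf⟩ := exists_mem_Icc_isFixedPt (hf.iterate _).continuousOn hy.le ih.le h1
    exact hno x ⟨huy.trans hx.1, hx.2.trans hyv⟩
      (Function.mk_mem_periodicPts (Nat.mul_pos hm k.succ_pos) hxf)

theorem iterate_lt_of_no_periodic {f : ℝ → ℝ} (hf : Continuous f) {u v : ℝ}
    (hno : ∀ x ∈ Icc u v, x ∉ Function.periodicPts f) {m : ℕ} (hm : 0 < m) {y : ℝ} (hyv : y ≤ v)
    (hy : f^[m] y < y) (huy : u ≤ f^[m] y) (k : ℕ) : f^[m * (k + 1)] y < y := by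
  induction k with
  | zero => simpa using hy
  | succ k ih =>
    by_contra hcon
    push Not at hcon
    have h1 : f^[m] y ≤ f^[m * (k + 1)] (f^[m] y) := by
      rw [← Function.iterate_add_apply]
      exact hy.le.trans hcon
    obtain ⟨x, hx, hxf⟩ := (isPreconnected_Icc (a := f^[m] y) (b := y)).intermediate_value₂
      (right_mem_Icc.2 hy.le) (left_mem_Icc.2 hy.le) (hf.iterate _).continuousOn continuousOn_id
      ih.le h1
    exact hno x ⟨huy.trans hx.1, hx.2.trans hyv⟩
      (Function.mk_mem_periodicPts (Nat.mul_pos hm k.succ_pos) hxf)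

/-- If s moves right in m steps and t > s moves left in k steps, then, were there no periodic
points, the common iterate mk would still move s right and t left, and the intermediate value
theorem would give a fixed point of it between them. -/
theorem exists_periodicPt_of_moves {f : ℝ → ℝ} (hf : Continuous f) {u v s t : ℝ} (hst : s < t)
    (hus : u ≤ s) (htv : t ≤ v) {m k : ℕ} (hm : 0 < m) (hk : 0 < k) (hs : s < f^[m] s)
    (hsv : f^[m] s ≤ v) (ht : f^[k] t < t) (hut : u ≤ f^[k] t) :
    ∃ x ∈ Icc u v, x ∈ Function.periodicPts f := by
  by_contra! hno
  have h1 := lt_iterate_of_no_periodic hf hno hm hus hs hsv (k - 1)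
  have h2 := iterate_lt_of_no_periodic hf hno hk htv ht hut (m - 1)
  rw [Nat.sub_add_cancel hk] at h1
  rw [Nat.sub_add_cancel hm, mul_comm] at h2
  obtain ⟨x, hx, hxf⟩ := exists_mem_Icc_isFixedPt (hf.iterate _).continuousOn hst.le h1.le h2.le
  exact hno x ⟨hus.trans hx.1, hx.2.trans htv⟩
    (Function.mk_mem_periodicPts (Nat.mul_pos hm hk) hxf)

/-- An interval in which some orbit is dense contains a periodic point. -/
theorem exists_periodicPt_of_dense_orbit {f : ℝ → ℝ} (hf : Continuous f) {u v w : ℝ} (huv : u < v)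
    (hd : Icc u v ⊆ closure (orbit f w)) : ∃ x ∈ Icc u v, x ∈ Function.periodicPts f := by
  -- Deleting the first finitely many orbit points from an open interval leaves a nonempty open set,
  -- so the orbit visits the interval arbitrarily late.
  have visit : ∀ s t, u ≤ s → s < t → t ≤ v → ∀ n₀, ∃ n > n₀, f^[n] w ∈ Ioo s t := by
    intro s t hs hst ht n₀
    have hfin : ((fun n => f^[n] w) '' Iic n₀).Finite := (finite_Iic n₀).image _
    obtain ⟨y, hy, hyn⟩ := (Ioo_infinite hst).exists_notMem_finite hfin
    have hopen : IsOpen (Ioo s t \ (fun n => f^[n] w) '' Iic n₀) :=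
      isOpen_Ioo.sdiff hfin.isClosed
    obtain ⟨z, hz, n, rfl⟩ := mem_closure_iff.1 (hd ⟨hs.trans hy.1.le, hy.2.le.trans ht⟩) _ hopen
      ⟨hy, hyn⟩
    refine ⟨n, ?_, hz.1⟩
    by_contra hn
    exact hz.2 ⟨n, not_lt.1 hn, rfl⟩
  obtain ⟨n₀, -, h0⟩ := visit u v le_rfl huv le_rfl 0
  obtain ⟨m, hm, h1⟩ := visit u v le_rfl huv le_rfl n₀
  obtain ⟨m, rfl⟩ := Nat.exists_eq_add_of_lt hm
  have e1 : f^[n₀ + m + 1] w = f^[m + 1] (f^[n₀] w) := by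
    rw [← Function.iterate_add_apply]; congr 1; omega
  -- Two visits give a point moved to one side; a third, later visit strictly between them shows
  -- that the second point is moved back.
  rcases lt_trichotomy (f^[n₀] w) (f^[n₀ + m + 1] w) with h | h | h
  · obtain ⟨n, hn, h2⟩ := visit _ _ h0.1.le h h1.2.le (n₀ + m + 1)
    obtain ⟨k, rfl⟩ := Nat.exists_eq_add_of_lt hn
    have e2 : f^[n₀ + m + 1 + k + 1] w = f^[k + 1] (f^[n₀ + m + 1] w) := by
      rw [← Function.iterate_add_apply]; congr 1; omega
    refine exists_periodicPt_of_moves hf h h0.1.le h1.2.le m.succ_pos k.succ_pos ?_ ?_ ?_ ?_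
    · rwa [← e1]
    · rw [← e1]; exact h1.2.le
    · rw [← e2]; exact h2.2
    · rw [← e2]; exact h0.1.le.trans h2.1.le
  · exact ⟨_, Ioo_subset_Icc_self h0, Function.mk_mem_periodicPts m.succ_pos (e1.symm.trans h.symm)⟩
  · obtain ⟨n, hn, h2⟩ := visit _ _ h1.1.le h h0.2.le (n₀ + m + 1)
    obtain ⟨k, rfl⟩ := Nat.exists_eq_add_of_lt hn
    have e2 : f^[n₀ + m + 1 + k + 1] w = f^[k + 1] (f^[n₀ + m + 1] w) := by
      rw [← Function.iterate_add_apply]; congr 1; omega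
    refine exists_periodicPt_of_moves hf h h1.1.le h0.2.le k.succ_pos m.succ_pos ?_ ?_ ?_ ?_
    · rw [← e2]; exact h2.1
    · rw [← e2]; exact h2.2.le.trans h0.2.le
    · rwa [← e1]
    · rw [← e1]; exact h1.1.le

/-- The saw map and the tent map agree only on a segment; this and the next lemmas carry dynamical
properties across such a local agreement, with invariance of the segment required for one of the two
maps only. -/
theorem iterate_eq_of_eqOn {f g : ℝ → ℝ} {S : Set ℝ} (h : EqOn f g S) (hm : MapsTo g S S)
    (n : ℕ) {x : ℝ} (hx : x ∈ S) : f^[n] x = g^[n] x := by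
  induction n with
  | zero => rfl
  | succ n ih =>
    rw [Function.iterate_succ_apply', Function.iterate_succ_apply', ih, h (hm.iterate n hx)]

theorem mem_periodicPts_of_eqOn {f g : ℝ → ℝ} {S : Set ℝ} (h : EqOn f g S) (hm : MapsTo g S S)
    {x : ℝ} (hx : x ∈ S) (hp : x ∈ Function.periodicPts g) : x ∈ Function.periodicPts f := by
  obtain ⟨n, hn, hpn⟩ := hp
  exact ⟨n, hn, (iterate_eq_of_eqOn h hm n hx).trans hpn⟩

theorem orbit_eq_of_eqOn {f g : ℝ → ℝ} {S : Set ℝ} (h : EqOn f g S) (hm : MapsTo g S S)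
    {x : ℝ} (hx : x ∈ S) : orbit f x = orbit g x := by
  unfold orbit
  congr 1
  funext n
  exact iterate_eq_of_eqOn h hm n hx

theorem IsChaotic.congr {f g : ℝ → ℝ} {A : Set ℝ} (hg : IsChaotic g A) (h : EqOn f g A) :
    IsChaotic f A := by
  have hm : MapsTo g A A := mapsTo_iff_image_subset.2 hg.invariant.subset
  refine ⟨hg.closed, (image_congr h).trans hg.invariant, ?_, ?_, ?_⟩
  · exact hg.dense_periodic.trans
      (closure_mono fun x hx => ⟨hx.1, mem_periodicPts_of_eqOn h hm hx.1 hx.2⟩)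
  · obtain ⟨δ, hδ, hs⟩ := hg.sensitive
    refine ⟨δ, hδ, fun x hx ε hε => ?_⟩
    obtain ⟨y, hy, hxy, n, hn⟩ := hs x hx ε hε
    refine ⟨y, hy, hxy, n, ?_⟩
    rwa [iterate_eq_of_eqOn h hm n hx, iterate_eq_of_eqOn h hm n hy]
  · obtain ⟨x, hx, hd⟩ := hg.dense_orbit
    exact ⟨x, hx, by rwa [orbit_eq_of_eqOn h hm hx]⟩

/-! ### The skew tent map -/

/-- The skew tent map with slopes `a`, `-b` and peak `(r, r + h)`. -/
noncomputable def tent (a b r h x : ℝ) : ℝ := r + h - max (a * (r - x)) (b * (x - r))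

section tent
variable {a b r h : ℝ}

theorem continuous_tent : Continuous (tent a b r h) := by
  unfold tent; fun_prop

theorem tent_left (ha : 0 ≤ a) (hb : 0 ≤ b) {x : ℝ} (hx : x ≤ r) :
    tent a b r h x = r + h - a * (r - x) := by
  unfold tent
  rw [max_eq_left]
  nlinarith [mul_nonneg ha (sub_nonneg.2 hx), mul_nonneg hb (sub_nonneg.2 hx)]

theorem tent_right (ha : 0 ≤ a) (hb : 0 ≤ b) {x : ℝ} (hx : r ≤ x) :
    tent a b r h x = r + h - b * (x - r) := by
  unfold tent
  rw [max_eq_right]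
  nlinarith [mul_nonneg ha (sub_nonneg.2 hx), mul_nonneg hb (sub_nonneg.2 hx)]

theorem tent_le (ha : 0 ≤ a) (hb : 0 ≤ b) (x : ℝ) : tent a b r h x ≤ r + h := by
  rcases le_total x r with hx | hx
  · rw [tent_left ha hb hx]; nlinarith [mul_nonneg ha (sub_nonneg.2 hx)]
  · rw [tent_right ha hb hx]; nlinarith [mul_nonneg hb (sub_nonneg.2 hx)]

end tent

/-- A point moved away from a repelling fixed point `z` with slope `β` eventually leaves any
bounded neighbourhood of `z`. -/
theorem exists_iterate_notMem {f : ℝ → ℝ} {β z ρ : ℝ} (hβ : 1 < |β|) {S : Set ℝ}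
    (hS : ∀ x ∈ S, |x - z| ≤ ρ) (hf : ∀ x ∈ S, f x - z = β * (x - z)) {x : ℝ} (hx : x ≠ z) :
    ∃ n : ℕ, f^[n] x ∉ S := by
  by_contra! hcon
  have key : ∀ n : ℕ, |f^[n] x - z| = |β| ^ n * |x - z| := by
    intro n
    induction n with
    | zero => simp
    | succ n ih =>
      rw [Function.iterate_succ_apply', hf _ (hcon n), abs_mul, ih]
      ring
  have hpos : 0 < |x - z| := abs_pos.2 (sub_ne_zero.2 hx)
  obtain ⟨n, hn⟩ := pow_unbounded_of_one_lt (ρ / |x - z|) hβ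
  have := hS _ (hcon n)
  rw [key, ← le_div_iff₀ hpos] at this
  linarith


/-- The conditions on the parameters under which the skew tent map is expanding and leaves the
segment between the second and the first image of the turning point invariant. -/
structure TentParam (a b h : ℝ) : Prop where
  one_lt_a : 1 < a
  one_lt_b : 1 < b
  h_pos : 0 < h
  mul_lt : a * b < a + b

namespace TentParam
variable {a b h r : ℝ} (P : TentParam a b h)
include P

theorem a_nonneg : 0 ≤ a := by linarith [P.one_lt_a]
theorem b_nonneg : 0 ≤ b := by linarith [P.one_lt_b]

theorem left {x : ℝ} (hx : x ≤ r) : tent a b r h x = r + h - a * (r - x) :=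
  tent_left P.a_nonneg P.b_nonneg hx

theorem right {x : ℝ} (hx : r ≤ x) : tent a b r h x = r + h - b * (x - r) :=
  tent_right P.a_nonneg P.b_nonneg hx

theorem low_lt : r + h - b * h < r := by nlinarith [P.one_lt_b, P.h_pos]

theorem mapsTo : MapsTo (tent a b r h) (Icc (r + h - b * h) (r + h)) (Icc (r + h - b * h) (r + h)) := by
  intro x hx
  refine ⟨?_, tent_le P.a_nonneg P.b_nonneg x⟩
  have := P.one_lt_a
  have := P.one_lt_b
  rcases le_total x r with h1 | h1
  -- The worst point is the low end r + h - bh, whose image is not below it because a(b - 1) < b,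
  -- that is, ab < a + b.
  · rw [P.left h1]
    nlinarith [hx.1, mul_pos P.h_pos (sub_pos.2 P.mul_lt)]
  · rw [P.right h1]
    nlinarith [hx.2]

theorem image_right {x y : ℝ} (hx : r ≤ x) (hxy : x ≤ y) :
    tent a b r h '' Icc x y = Icc (tent a b r h y) (tent a b r h x) := by
  have hb := P.one_lt_b
  ext w
  rw [P.right hx, P.right (hx.trans hxy)]
  constructor
  · rintro ⟨v, hv, rfl⟩
    rw [P.right (hx.trans hv.1)]
    constructor <;> nlinarith [hv.1, hv.2]
  · intro hw
    have h1 : x ≤ r + (r + h - w) / b := by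
      rw [← sub_le_iff_le_add', le_div_iff₀ (by linarith)]
      nlinarith [hw.2]
    have h2 : r + (r + h - w) / b ≤ y := by
      rw [← le_sub_iff_add_le', div_le_iff₀ (by linarith)]
      nlinarith [hw.1]
    refine ⟨_, ⟨h1, h2⟩, ?_⟩
    rw [P.right (hx.trans h1)]
    field_simp
    ring

theorem image_right_top : tent a b r h '' Icc r (r + h) = Icc (r + h - b * h) (r + h) := by
  rw [P.image_right le_rfl (by linarith [P.h_pos]), P.right le_rfl,
    P.right (by linarith [P.h_pos])]
  congr 1 <;> ring

theorem image_core :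
    tent a b r h '' Icc (r + h - b * h) (r + h) = Icc (r + h - b * h) (r + h) := by
  refine (mapsTo_iff_image_subset.1 P.mapsTo).antisymm ?_
  exact P.image_right_top.symm.subset.trans (image_mono (Icc_subset_Icc_left P.low_lt.le))

theorem tent_peak : tent a b r h r = r + h := by rw [P.left le_rfl]; ring

theorem tent_top : tent a b r h (r + h) = r + h - b * h := by
  rw [P.right (by linarith [P.h_pos])]; ring

theorem fixed : tent a b r h (r + h / (1 + b)) = r + h / (1 + b) := by
  have := P.one_lt_b
  have h1 : 0 < h / (1 + b) := div_pos P.h_pos (by linarith)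
  rw [P.right (by linarith)]
  field_simp
  ring

theorem expand {x y : ℝ} (hxy : x < r ∧ y < r ∨ r < x ∧ r < y) :
    min a b * |x - y| ≤ |tent a b r h x - tent a b r h y| := by
  rcases hxy with ⟨hx, hy⟩ | ⟨hx, hy⟩
  · rw [P.left hx.le, P.left hy.le,
      show r + h - a * (r - x) - (r + h - a * (r - y)) = a * (x - y) by ring, abs_mul,
      abs_of_nonneg P.a_nonneg]
    exact mul_le_mul_of_nonneg_right (min_le_left _ _) (abs_nonneg _)
  · rw [P.right hx.le, P.right hy.le,
      show r + h - b * (x - r) - (r + h - b * (y - r)) = -(b * (x - y)) by ring, abs_neg, abs_mul,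
      abs_of_nonneg P.b_nonneg]
    exact mul_le_mul_of_nonneg_right (min_le_right _ _) (abs_nonneg _)

end TentParam

theorem same_side_of_notMem {S : Set ℝ} (hS : IsPreconnected S) {r x y : ℝ} (hr : r ∉ S)
    (hx : x ∈ S) (hy : y ∈ S) : x < r ∧ y < r ∨ r < x ∧ r < y := by
  have hoc := hS.ordConnected
  have hxr : x ≠ r := fun h => hr (h ▸ hx)
  have hyr : y ≠ r := fun h => hr (h ▸ hy)
  rcases hxr.lt_or_gt with h1 | h1 <;> rcases hyr.lt_or_gt with h2 | h2
  · exact Or.inl ⟨h1, h2⟩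
  · exact absurd (hoc.out hx hy ⟨h1.le, h2.le⟩) hr
  · exact absurd (hoc.out hy hx ⟨h2.le, h1.le⟩) hr
  · exact Or.inr ⟨h1, h2⟩

/-! ### Spreading of segments under an expanding tent map -/

namespace TentParam
variable {a b h r : ℝ} (P : TentParam a b h)
include P

/-- While the images avoid the turning point they lie on one branch, so distances grow by at least
min(a, b) > 1 per step; this cannot go on inside the core, whose length is bh. -/
theorem exists_turning_mem_image {S : Set ℝ} (hS : IsPreconnected S)
    (hSG : S ⊆ Icc (r + h - b * h) (r + h)) {x y : ℝ} (hx : x ∈ S) (hy : y ∈ S) (hxy : x ≠ y) :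
    ∃ n : ℕ, r ∈ (tent a b r h)^[n] '' S := by
  by_contra! hcon
  set f := tent a b r h with hf
  have hmin : 1 < min a b := lt_min P.one_lt_a P.one_lt_b
  have key : ∀ n : ℕ, min a b ^ n * |x - y| ≤ |f^[n] x - f^[n] y| := by
    intro n
    induction n with
    | zero => simp
    | succ n ih =>
      have hside := same_side_of_notMem
        (hS.image _ ((continuous_tent (a := a) (b := b) (r := r) (h := h)).iterate n).continuousOn)
        (hcon n) (mem_image_of_mem _ hx) (mem_image_of_mem _ hy)
      have h1 := P.expand (r := r) hside
      rw [Function.iterate_succ_apply', Function.iterate_succ_apply', pow_succ']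
      refine le_trans ?_ h1
      rw [mul_assoc]
      exact mul_le_mul_of_nonneg_left ih (by linarith)
  have hpos : 0 < |x - y| := abs_pos.2 (sub_ne_zero.2 hxy)
  obtain ⟨n, hn⟩ := pow_unbounded_of_one_lt (b * h / |x - y|) hmin
  rw [div_lt_iff₀ hpos] at hn
  have h1 := P.mapsTo.iterate n (hSG hx)
  have h2 := P.mapsTo.iterate n (hSG hy)
  have h3 : |f^[n] x - f^[n] y| ≤ b * h := by
    rw [abs_le]; constructor <;> linarith [h1.1, h1.2, h2.1, h2.2]
  linarith [key n]

theorem lt_peak {x : ℝ} (hx : x ≠ r) : tent a b r h x < r + h := by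
  have := P.one_lt_a
  have := P.one_lt_b
  rcases hx.lt_or_gt with h1 | h1
  · rw [P.left h1.le]; nlinarith
  · rw [P.right h1.le]; nlinarith

/-- The iterates of the map are not constant on nondegenerate segments. -/
theorem exists_iterate_ne {S : Set ℝ} (hS : IsPreconnected S) {x y : ℝ} (hx : x ∈ S) (hy : y ∈ S)
    (hxy : x ≠ y) (n : ℕ) :
    ∃ s ∈ S, ∃ t ∈ S, (tent a b r h)^[n] s ≠ (tent a b r h)^[n] t := by
  set f := tent a b r h with hf
  induction n with
  | zero => exact ⟨x, hx, y, hy, hxy⟩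
  | succ n ih =>
    obtain ⟨s, hs, t, ht, hst⟩ := ih
    simp only [Function.iterate_succ_apply']
    -- If the image contains r, that point goes to the peak and any other point goes strictly lower;
    -- otherwise the image lies on one branch, where f is injective.
    by_cases hr : r ∈ f^[n] '' S
    · obtain ⟨w, hw, hwr⟩ := hr
      obtain ⟨v, hv, hvr⟩ : ∃ v ∈ S, f^[n] v ≠ r := by
        by_cases h1 : f^[n] s = r
        · exact ⟨t, ht, fun h2 => hst (h1.trans h2.symm)⟩
        · exact ⟨s, hs, h1⟩
      refine ⟨v, hv, w, hw, ?_⟩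
      rw [hwr, hf, P.tent_peak]
      exact (P.lt_peak hvr).ne
    · have h1 := P.expand (r := r) (same_side_of_notMem
        (hS.image _ ((continuous_tent (a := a) (b := b) (r := r) (h := h)).iterate n).continuousOn)
        hr ⟨s, hs, rfl⟩ ⟨t, ht, rfl⟩)
      refine ⟨s, hs, t, ht, fun h2 => ?_⟩
      rw [← hf, h2, sub_self, abs_zero] at h1
      have h3 := mul_pos (show 0 < min a b from
        lt_min (by linarith [P.one_lt_a]) (by linarith [P.one_lt_b]))
        (abs_pos.2 (sub_ne_zero.2 hst))
      linarith

/-- After multiplication by 1 + b the inequality b/(1 + b) ≤ a(b - 1) is the hypothesis; this is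
where the threshold a + b = ab² comes from. -/
theorem third_image_le (hn : a + b ≤ a * b ^ 2) :
    tent a b r h (r + h - b * h) ≤ r + h / (1 + b) := by
  have := P.one_lt_b
  have h1 : b * h ≤ a * (b - 1) * h * (1 + b) := by nlinarith [P.h_pos]
  have h2 : h / (1 + b) = h - b * h / (1 + b) := by field_simp; ring
  have h3 : b * h / (1 + b) ≤ a * (b - 1) * h := by rwa [div_le_iff₀ (by linarith)]
  rw [P.left P.low_lt.le, h2]
  nlinarith

/-- In the non-renormalizable case the forward images of a segment of the core cover the core. -/
theorem iUnion_image_eq_core (hn : a + b ≤ a * b ^ 2) {x y : ℝ} (hxy : x < y)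
    (hG : Icc x y ⊆ Icc (r + h - b * h) (r + h)) :
    Icc (r + h - b * h) (r + h) ⊆ ⋃ n : ℕ, (tent a b r h)^[n] '' Icc x y := by
  set f := tent a b r h with hf
  have hcont : Continuous f := continuous_tent
  set A := ⋃ n : ℕ, f^[n] '' Icc x y with hA
  have hb := P.one_lt_b
  have ha := P.one_lt_a
  have hh := P.h_pos
  have hAG : A ⊆ Icc (r + h - b * h) (r + h) := by
    refine iUnion_subset fun n => ?_
    rintro _ ⟨w, hw, rfl⟩
    exact P.mapsTo.iterate n (hG hw)
  have hfA : MapsTo f A A := by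
    intro w hw
    obtain ⟨n, v, hv, rfl⟩ := mem_iUnion.1 hw
    exact mem_iUnion.2 ⟨n + 1, v, hv, Function.iterate_succ_apply' f n v⟩
  -- it is enough to find the segment between the fixed point and the top
  suffices hz : Icc (r + h / (1 + b)) (r + h) ⊆ A by
    have h1 : f '' Icc (r + h / (1 + b)) (r + h) = Icc (r + h - b * h) (r + h / (1 + b)) := by
      have h0 : h / (1 + b) ≤ h := div_le_self hh.le (by linarith)
      have h0' : 0 ≤ h / (1 + b) := div_nonneg hh.le (by linarith)
      rw [P.image_right (by linarith) (by linarith), P.fixed, P.tent_top]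
    intro w hw
    rcases le_total w (r + h / (1 + b)) with h2 | h2
    · have : w ∈ f '' Icc (r + h / (1 + b)) (r + h) := by rw [h1]; exact ⟨hw.1, h2⟩
      obtain ⟨v, hv, rfl⟩ := this
      exact hfA (hz hv)
    · exact hz ⟨h2, hw.2⟩
  -- the turning point and the top are in `A`
  obtain ⟨m, hm⟩ := P.exists_turning_mem_image (r := r) isPreconnected_Icc hG
    (left_mem_Icc.2 hxy.le) (right_mem_Icc.2 hxy.le) hxy.ne
  set S := f^[m] '' Icc x y with hS
  have hSpre : IsPreconnected S := isPreconnected_Icc.image _ (hcont.iterate m).continuousOn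
  have hSA : S ⊆ A := subset_iUnion (fun n => f^[n] '' Icc x y) m
  have hrA : r ∈ A := hSA hm
  have htop : f r = r + h := P.tent_peak
  have hcA : r + h ∈ A := htop ▸ hfA hrA
  -- C and K are the components of A at the top and at the turning point, and f(K) ⊆ C. It will be
  -- enough that C reaches down to z, and for this the first return of C to the turning point is
  -- followed.
  set C := connectedComponentIn A (r + h) with hC
  set K := connectedComponentIn A r with hK
  have hCpre : IsPreconnected C := isPreconnected_connectedComponentIn
  have hKpre : IsPreconnected K := isPreconnected_connectedComponentIn
  have hCA : C ⊆ A := connectedComponentIn_subset _ _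
  have hcC : r + h ∈ C := mem_connectedComponentIn hcA
  have hrK : r ∈ K := mem_connectedComponentIn hrA
  have hfK : f '' K ⊆ C := by
    refine (hKpre.image _ hcont.continuousOn).subset_connectedComponentIn ⟨r, hrK, htop⟩ ?_
    exact (image_mono (connectedComponentIn_subset _ _)).trans hfA.image_subset
  suffices hz : ∃ w ∈ C, w ≤ r + h / (1 + b) by
    obtain ⟨w, hw, hwz⟩ := hz
    exact (Icc_subset_Icc_left hwz).trans ((hCpre.ordConnected.out hw hcC).trans hCA)
  -- `C` is nondegenerate
  obtain ⟨w, hwC, hwne⟩ : ∃ w ∈ C, w ≠ r + h := by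
    have hne : ∃ s ∈ S, s ≠ r := by
      by_contra! hcon
      obtain ⟨s, hs, t, ht, hst⟩ := P.exists_iterate_ne (r := r) isPreconnected_Icc
        (left_mem_Icc.2 hxy.le) (right_mem_Icc.2 hxy.le) hxy.ne m
      exact hst ((hcon _ ⟨s, hs, rfl⟩).trans (hcon _ ⟨t, ht, rfl⟩).symm)
    obtain ⟨s, hs, hsr⟩ := hne
    have hSK : S ⊆ K := hSpre.subset_connectedComponentIn hm hSA
    exact ⟨f s, hfK ⟨s, hSK hs, rfl⟩, (P.lt_peak hsr).ne⟩
  have hfC : ∀ j : ℕ, f^[j] '' C ⊆ A := by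
    intro j
    rintro _ ⟨v, hv, rfl⟩
    exact hfA.iterate j (hCA hv)
  have hfCpre : ∀ j : ℕ, IsPreconnected (f^[j] '' C) := fun j =>
    hCpre.image _ (hcont.iterate j).continuousOn
  classical
  have hex := P.exists_turning_mem_image hCpre (hCA.trans hAG) hwC hcC hwne
  obtain ⟨j, hj, hjmin⟩ : ∃ j : ℕ, r ∈ f^[j] '' C ∧ ∀ i < j, r ∉ f^[i] '' C :=
    ⟨Nat.find hex, Nat.find_spec hex, fun i hi => Nat.find_min hex hi⟩
  have hjK : f^[j] '' C ⊆ K := (hfCpre j).subset_connectedComponentIn hj (hfC j)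
  have hzr : 0 < h / (1 + b) := div_pos hh (by linarith)
  match j, hj, hjmin, hjK with
  | 0, hj, _, _ =>
    rw [Function.iterate_zero, image_id] at hj
    exact ⟨r, hj, by linarith⟩
  -- Here f(C) ⊆ K, so the image of the top is in K and its second image is in C; by
  -- `third_image_le` that second image is at most z.
  | 1, _, _, hjK =>
    refine ⟨f (f (r + h)), hfK ⟨_, hjK ⟨r + h, hcC, rfl⟩, rfl⟩, ?_⟩
    rw [show f (r + h) = _ from P.tent_top]
    exact P.third_image_le hn
  | j + 2, _, hjmin, hjK =>
    exfalso
    -- the lower bound on the length of `f^[j + 2] '' C`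
    have hup : ∀ v ∈ C, ∀ i : ℕ, i ≤ j →
        a * b * |v - (r + h)| ≤ |f^[i + 2] v - f^[i + 2] (r + h)| := by
      intro v hv i
      induction i with
      | zero =>
        intro _
        have h0 : r ∉ C := by
          have := hjmin 0 (by omega)
          rwa [Function.iterate_zero, image_id] at this
        have h1 : r ∉ f '' C := by simpa using hjmin 1 (by omega)
        have hvr : r < v := by
          rcases same_side_of_notMem hCpre h0 hv hcC with h2 | h2
          · linarith [h2.2]
          · exact h2.1
        have hfv : f v < r := by
          rcases same_side_of_notMem (hCpre.image _ hcont.continuousOn) h1 (mem_image_of_mem f hv)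
            (mem_image_of_mem f hcC) with h2 | h2
          · exact h2.1
          · rw [show f (r + h) = _ from P.tent_top] at h2
            nlinarith [h2.2]
        change _ ≤ |f (f v) - f (f (r + h))|
        have hfv' : f v = r + h - b * (v - r) := P.right hvr.le
        rw [show f (r + h) = _ from P.tent_top, hf, P.left hfv.le, P.left P.low_lt.le, hfv',
          show r + h - a * (r - (r + h - b * (v - r))) - (r + h - a * (r - (r + h - b * h)))
            = -(a * b * (v - (r + h))) by ring, abs_neg, abs_mul,
          abs_of_pos (by positivity : 0 < a * b)]
      | succ i ih =>
        intro hi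
        have h1 := P.expand (r := r) (same_side_of_notMem (hfCpre (i + 2)) (hjmin (i + 2) (by omega))
          (mem_image_of_mem _ hv) (mem_image_of_mem _ hcC))
        rw [Function.iterate_succ_apply' f (i + 2), Function.iterate_succ_apply' f (i + 2)]
        have h2 := ih (by omega)
        have h3 : 1 ≤ min a b := le_min ha.le hb.le
        nlinarith [abs_nonneg (f^[i + 2] v - f^[i + 2] (r + h))]
    -- the bound on the distance of the points of `C` to the top
    have hbdd : BddBelow C := ⟨r + h - b * h, fun v hv => (hAG (hCA hv)).1⟩
    set l := sInf C with hl
    set d := r + h - l with hd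
    have hlC : ∀ v ∈ C, l ≤ v := fun v hv => csInf_le hbdd hv
    have hdpos : 0 < d := by
      have h1 := hlC w hwC
      have h2 : w < r + h := lt_of_le_of_ne (hAG (hCA hwC)).2 hwne
      linarith
    have hKl : ∀ v ∈ K, r - d / a ≤ v ∧ v ≤ r + d / b := by
      intro v hv
      have h1 := hlC _ (hfK ⟨v, hv, rfl⟩)
      have hda : 0 < d / a := by positivity
      have hdb : 0 < d / b := by positivity
      rcases le_total v r with h2 | h2
      · rw [show f v = _ from P.left h2] at h1
        have : r - v ≤ d / a := by rw [le_div_iff₀ (by linarith)]; linarith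
        constructor <;> linarith
      · rw [show f v = _ from P.right h2] at h1
        have : v - r ≤ d / b := by rw [le_div_iff₀ (by linarith)]; linarith
        constructor <;> linarith
    have hdist : ∀ v ∈ C, a * b * (r + h - v) ≤ d / a + d / b := by
      intro v hv
      have h1 := hup v hv j le_rfl
      have h2 := hKl _ (hjK (mem_image_of_mem _ hv))
      have h3 := hKl _ (hjK (mem_image_of_mem _ hcC))
      have h4 : |f^[j + 2] v - f^[j + 2] (r + h)| ≤ d / a + d / b := by
        rw [abs_le]; constructor <;> linarith [h2.1, h2.2, h3.1, h3.2]
      rw [abs_sub_comm, abs_of_nonneg (by linarith [(hAG (hCA hv)).2])] at h1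
      linarith
    have hfin : a * b * d ≤ d / a + d / b := by
      have h1 : r + h - (d / a + d / b) / (a * b) ≤ l := by
        refine le_csInf ⟨_, hcC⟩ fun v hv => ?_
        have h2 := hdist v hv
        have : r + h - v ≤ (d / a + d / b) / (a * b) := by
          rw [le_div_iff₀ (by positivity)]; linarith
        linarith
      have h2 : d ≤ (d / a + d / b) / (a * b) := by linarith
      rw [le_div_iff₀ (by positivity)] at h2
      linarith
    -- With d the length of C: the image f^(j+2)(C) has length at least ab·d and lies in K, while
    -- f(K) ⊆ C bounds the length of K by d/a + d/b. Hence (ab)² ≤ a + b ≤ ab², which is impossible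
    -- for a > 1.
    have hfin2 : a * b * (a * b) ≤ a + b := by
      have h1 : a * b * d * (a * b) ≤ (d / a + d / b) * (a * b) :=
        mul_le_mul_of_nonneg_right hfin (by positivity)
      have h2 : (d / a + d / b) * (a * b) = (a + b) * d := by field_simp; ring
      rw [h2] at h1
      nlinarith
    nlinarith [mul_pos (show 0 < a * b ^ 2 by positivity) (sub_pos.2 ha)]

end TentParam

theorem exists_subsegment {l u x ε : ℝ} (hlu : l < u) (hx : x ∈ Icc l u) (hε : 0 < ε) :
    ∃ s t, s < t ∧ x ∈ Icc s t ∧ Icc s t ⊆ Icc l u ∧ ∀ y ∈ Icc s t, |y - x| < ε := by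
  refine ⟨max l (x - ε / 2), min u (x + ε / 2), ?_, ?_, ?_, ?_⟩
  · rw [max_lt_iff, lt_min_iff, lt_min_iff]
    refine ⟨⟨hlu, ?_⟩, ?_, ?_⟩ <;> linarith [hx.1, hx.2]
  · refine ⟨max_le hx.1 (by linarith), le_min hx.2 (by linarith)⟩
  · exact Icc_subset_Icc (le_max_left _ _) (min_le_left _ _)
  · intro y hy
    have h1 := (le_max_right l (x - ε / 2)).trans hy.1
    have h2 := hy.2.trans (min_le_right u (x + ε / 2))
    rw [abs_lt]
    constructor <;> linarith

namespace TentParam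
variable {a b h r : ℝ} (P : TentParam a b h)
include P

theorem fixed_mem : r + h / (1 + b) ∈ Icc (r + h - b * h) (r + h) := by
  have h1 := P.low_lt (r := r)
  have h2 : h / (1 + b) ≤ h := div_le_self P.h_pos.le (by linarith [P.one_lt_b])
  have h3 : 0 ≤ h / (1 + b) := div_nonneg P.h_pos.le (by linarith [P.one_lt_b])
  constructor <;> linarith

/-- The radius h/(1 + b) is the distance from the fixed point to the turning point, so the whole
neighbourhood lies on the decreasing branch. -/
theorem near_fixed {x : ℝ} (hx : |x - (r + h / (1 + b))| < h / (1 + b)) :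
    tent a b r h x - (r + h / (1 + b)) = -b * (x - (r + h / (1 + b))) := by
  have h1 := (abs_lt.1 hx).1
  have h2 : (r + h - b * (r + h / (1 + b) - r)) = r + h / (1 + b) := by
    have := P.one_lt_b
    field_simp
    ring
  rw [P.right (by linarith)]
  linarith

/-- In the non-renormalizable case the map is chaotic on the core. -/
theorem isChaotic_core (hn : a + b ≤ a * b ^ 2) :
    IsChaotic (tent a b r h) (Icc (r + h - b * h) (r + h)) := by
  set f := tent a b r h with hf
  have hcont : Continuous f := continuous_tent
  have hlu : r + h - b * h < r + h := by nlinarith [P.one_lt_b, P.h_pos]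
  have horb : ∃ x ∈ Icc (r + h - b * h) (r + h), Icc (r + h - b * h) (r + h) ⊆ closure (orbit f x) := by
    refine exists_dense_orbit hcont isClosed_Icc ⟨_, left_mem_Icc.2 hlu.le⟩ P.mapsTo ?_
    intro x hx y hy ε hε
    obtain ⟨s, t, hst, -, hsub, hnear⟩ := exists_subsegment hlu hx hε
    obtain ⟨n, z, hz, hzy⟩ := mem_iUnion.1 (P.iUnion_image_eq_core hn hst hsub hy)
    refine ⟨z, hsub hz, hnear z hz, n, ?_⟩
    rw [hzy, sub_self, abs_zero]
    exact hε
  refine ⟨isClosed_Icc, P.image_core, ?_, ?_, horb⟩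
  · obtain ⟨w, -, hw⟩ := horb
    intro x hx
    rw [Metric.mem_closure_iff]
    intro ε hε
    obtain ⟨s, t, hst, -, hsub, hnear⟩ := exists_subsegment hlu hx hε
    obtain ⟨p, hp, hper⟩ := exists_periodicPt_of_dense_orbit hcont hst (hsub.trans hw)
    refine ⟨p, ⟨hsub hp, hper⟩, ?_⟩
    rw [dist_comm, Real.dist_eq]
    exact hnear p hp
  · have hb := P.one_lt_b
    have hρ : 0 < h / (1 + b) := div_pos P.h_pos (by linarith)
    set z := r + h / (1 + b) with hz
    -- At one moment y sits at z while w is at least h/(1 + b) away from z, so x cannot shadow both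
    -- within a third of this distance.
    refine ⟨h / (1 + b) / 3, by positivity, fun x hx ε hε => ?_⟩
    obtain ⟨s, t, hst, hxs, hsub, hnear⟩ := exists_subsegment hlu hx hε
    -- a point of the segment whose trajectory hits the fixed point
    obtain ⟨n, y, hy, hyz⟩ := mem_iUnion.1 (P.iUnion_image_eq_core hn hst hsub P.fixed_mem)
    -- a point of the segment which is not mapped to the fixed point by the same iterate
    obtain ⟨w, hw, hwz⟩ : ∃ w ∈ Icc s t, f^[n] w ≠ z := by
      by_contra! hcon
      obtain ⟨v, hv, w, hw, hvw⟩ := P.exists_iterate_ne (r := r) isPreconnected_Icc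
        (left_mem_Icc.2 hst.le) (right_mem_Icc.2 hst.le) hst.ne n
      exact hvw ((hcon v hv).trans (hcon w hw).symm)
    have hb' : 1 < |-b| := by rwa [abs_neg, abs_of_pos (by linarith)]
    obtain ⟨m, hm⟩ := exists_iterate_notMem (S := {v | |v - z| < h / (1 + b)}) hb'
      (fun v hv => le_of_lt hv) (fun v hv => P.near_fixed hv) hwz
    rw [mem_ofPred_eq, ← Function.iterate_add_apply, not_lt] at hm
    have hym : f^[m + n] y = z := by
      rw [Function.iterate_add_apply, hyz]
      exact Function.iterate_fixed P.fixed m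
    by_contra! hcon
    have h1 := hcon y (hsub hy) (by rw [abs_sub_comm]; exact hnear y hy) (m + n)
    have h2 := hcon w (hsub hw) (by rw [abs_sub_comm]; exact hnear w hw) (m + n)
    rw [hym] at h1
    have h3 := abs_sub_le (f^[m + n] w) (f^[m + n] x) z
    rw [abs_sub_comm (f^[m + n] w) (f^[m + n] x)] at h3
    linarith

end TentParam

/-! ### Cycles of intervals and their doubling -/

/-- The structure of the map on the segment `[l, u]` with a chaotic cycle `Λ` of `2 ^ N` intervals
`[A i, B i]` and `N` periodic orbits, the orbits of the points `x i`. -/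
structure IntervalCycle (f : ℝ → ℝ) (l u : ℝ) (N : ℕ) (A B x : ℕ → ℝ) (Λ : Set ℝ) : Prop where
  lt : ∀ i ∈ Icc 1 (2 ^ N), A i < B i
  union : Λ = ⋃ i ∈ Icc 1 (2 ^ N), Icc (A i) (B i)
  subset : Λ ⊆ Icc l u
  chaotic : IsChaotic f Λ
  map_succ : ∀ i, 1 ≤ i → i + 1 ≤ 2 ^ N → f '' Icc (A i) (B i) = Icc (A (i + 1)) (B (i + 1))
  map_last : f '' Icc (A (2 ^ N)) (B (2 ^ N)) = Icc (A 1) (B 1)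
  order : ∀ i, 1 ≤ i → i + 1 ≤ 2 ^ N → B (sigma N i) < A (sigma N (i + 1))
  minimalPeriod : ∀ i ∈ Icc 1 N, Function.minimalPeriod f (x i) = 2 ^ (i - 1)
  orbit_subset : ∀ i ∈ Icc 1 N, orbit f (x i) ⊆ Icc l u \ Λ
  unstable : ∀ i ∈ Icc 1 N, ¬ IsStable (Icc l u) f (orbit f (x i))
  -- The first orbit is excluded only as a starting position: it is the fixed point z in the gap,
  -- which has no other preimage in the segment. The later orbits can be hit from outside.
  absorb : ∀ y ∈ Icc l u, (∀ i ∈ Icc 1 N, y ∉ orbit f (x i)) →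
    (∀ i ∈ Icc 2 N, ∀ n : ℕ, f^[n] y ∉ orbit f (x i)) → ∃ n : ℕ, f^[n] y ∈ Λ

theorem self_mem_orbit (f : ℝ → ℝ) (x : ℝ) : x ∈ orbit f x := ⟨0, rfl⟩

theorem IsStable.congr {f g : ℝ → ℝ} {X O : Set ℝ} (hf : IsStable X f O) (h : EqOn f g X)
    (hm : MapsTo g X X) : IsStable X g O := by
  intro ε hε
  obtain ⟨δ, hδ, hs⟩ := hf ε hε
  refine ⟨δ, hδ, fun x hx hxO n => ?_⟩
  rw [← iterate_eq_of_eqOn h hm n hx]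
  exact hs x hx hxO n

theorem IsStable.mono {f : ℝ → ℝ} {X Y O : Set ℝ} (hf : IsStable X f O) (h : Y ⊆ X) :
    IsStable Y f O := fun ε hε =>
  let ⟨δ, hδ, hs⟩ := hf ε hε
  ⟨δ, hδ, fun x hx => hs x (h hx)⟩

theorem IntervalCycle.congr {f g : ℝ → ℝ} {l u : ℝ} {N : ℕ} {A B x : ℕ → ℝ} {Λ : Set ℝ}
    (hg : IntervalCycle g l u N A B x Λ) (h : EqOn f g (Icc l u))
    (hm : MapsTo g (Icc l u) (Icc l u)) : IntervalCycle f l u N A B x Λ := by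
  have hsub : ∀ i ∈ Icc 1 (2 ^ N), Icc (A i) (B i) ⊆ Icc l u := by
    intro i hi
    refine subset_trans ?_ hg.subset
    rw [hg.union]
    exact fun y hy => mem_biUnion hi hy
  have hx : ∀ i ∈ Icc 1 N, x i ∈ Icc l u := fun i hi =>
    (hg.orbit_subset i hi (self_mem_orbit g _)).1
  have horb : ∀ i ∈ Icc 1 N, orbit f (x i) = orbit g (x i) := fun i hi =>
    orbit_eq_of_eqOn h hm (hx i hi)
  have hpow : 1 ≤ 2 ^ N := Nat.one_le_two_pow
  refine ⟨hg.lt, hg.union, hg.subset, hg.chaotic.congr (h.mono hg.subset), ?_, ?_, hg.order, ?_,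
    ?_, ?_, ?_⟩
  · intro i h1 h2
    rw [← hg.map_succ i h1 h2]
    exact image_congr (h.mono (hsub i ⟨h1, by omega⟩))
  · rw [← hg.map_last]
    exact image_congr (h.mono (hsub _ ⟨hpow, le_rfl⟩))
  · intro i hi
    rw [← hg.minimalPeriod i hi, Function.minimalPeriod_eq_minimalPeriod_iff]
    intro n
    unfold Function.IsPeriodicPt Function.IsFixedPt
    rw [iterate_eq_of_eqOn h hm n (hx i hi)]
  · intro i hi
    rw [horb i hi]
    exact hg.orbit_subset i hi
  · intro i hi
    rw [horb i hi]
    exact fun hs => hg.unstable i hi (hs.congr h hm)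
  · intro y hy h1 h2
    obtain ⟨n, hn⟩ := hg.absorb y hy (fun i hi => by rw [← horb i hi]; exact h1 i hi)
      (fun i hi n => by
        rw [← horb i ⟨(by decide : 1 ≤ 2).trans hi.1, hi.2⟩, ← iterate_eq_of_eqOn h hm n hy]
        exact h2 i hi n)
    exact ⟨n, by rwa [iterate_eq_of_eqOn h hm n hy]⟩

theorem sigma_le (N : ℕ) : ∀ i, 1 ≤ i → i ≤ 2 ^ N → sigma N i ≤ 2 ^ N := by
  induction N with
  | zero => intro i _ _; simp [sigma]
  | succ N ih =>
    intro i h1 h2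
    rw [pow_succ] at h2 ⊢
    simp only [sigma]
    split_ifs with h
    · have := ih (i - 2 ^ N) (by omega) (by omega); omega
    · have := ih (2 ^ N + 1 - i) (by omega) (by omega); omega

theorem sigma_injOn (N : ℕ) : InjOn (sigma N) (Icc 1 (2 ^ N)) := by
  induction N with
  | zero =>
    intro i hi j hj _
    simp only [pow_zero, mem_Icc] at hi hj
    omega
  | succ N ih =>
    intro i hi j hj hij
    simp only [mem_Icc, pow_succ] at hi hj
    simp only [sigma] at hij
    split_ifs at hij with h1 h2 h2
    · have p1 := sigma_pos N (i - 2 ^ N) (by omega) (by omega)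
      have p2 := sigma_pos N (j - 2 ^ N) (by omega) (by omega)
      have := ih (mem_Icc.2 ⟨by omega, by omega⟩) (mem_Icc.2 ⟨by omega, by omega⟩)
        (show sigma N (i - 2 ^ N) = sigma N (j - 2 ^ N) by omega)
      omega
    · have p1 := sigma_pos N (i - 2 ^ N) (by omega) (by omega)
      omega
    · have p1 := sigma_pos N (j - 2 ^ N) (by omega) (by omega)
      omega
    · have := ih (mem_Icc.2 ⟨by omega, by omega⟩) (mem_Icc.2 ⟨by omega, by omega⟩)
        (show sigma N (2 ^ N + 1 - i) = sigma N (2 ^ N + 1 - j) by omega)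
      omega

theorem sigma_bijOn (N : ℕ) : BijOn (sigma N) (Icc 1 (2 ^ N)) (Icc 1 (2 ^ N)) := by
  have hm : MapsTo (sigma N) (Icc 1 (2 ^ N)) (Icc 1 (2 ^ N)) := fun i hi =>
    ⟨sigma_pos N i hi.1 hi.2, sigma_le N i hi.1 hi.2⟩
  refine ⟨hm, sigma_injOn N, ?_⟩
  have hfin : (Icc 1 (2 ^ N)).Finite := finite_Icc _ _
  exact ((hfin.injOn_iff_bijOn_of_mapsTo hm).1 (sigma_injOn N)).surjOn

/-- The order condition compares only neighbours; chaining it along the line and using that `sigma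
N` is a bijection gives all pairs. -/
theorem IntervalCycle.disjoint {f : ℝ → ℝ} {l u : ℝ} {N : ℕ} {A B x : ℕ → ℝ} {Λ : Set ℝ}
    (hc : IntervalCycle f l u N A B x Λ) :
    ∀ i ∈ Icc 1 (2 ^ N), ∀ j ∈ Icc 1 (2 ^ N), i ≠ j →
      Disjoint (Icc (A i) (B i)) (Icc (A j) (B j)) := by
  have key : ∀ d i, 1 ≤ i → i + d + 1 ≤ 2 ^ N → B (sigma N i) < A (sigma N (i + d + 1)) := by
    intro d
    induction d with
    | zero => exact fun i => hc.order i
    | succ d ih =>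
      intro i h1 h2
      have h3 := hc.lt (sigma N (i + d + 1))
        ((sigma_bijOn N).mapsTo ⟨by omega, by omega⟩)
      exact ((ih i h1 (by omega)).trans h3).trans (hc.order (i + d + 1) (by omega) (by omega))
  have key2 : ∀ i j, 1 ≤ i → i < j → j ≤ 2 ^ N →
      Disjoint (Icc (A (sigma N i)) (B (sigma N i))) (Icc (A (sigma N j)) (B (sigma N j))) := by
    intro i j h1 h2 h3
    obtain ⟨d, rfl⟩ := Nat.exists_eq_add_of_lt h2
    refine Set.disjoint_left.2 fun y hy hy' => ?_
    linarith [key d i h1 h3, hy.2, hy'.1]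
  intro i hi j hj hij
  obtain ⟨i', hi', rfl⟩ := (sigma_bijOn N).surjOn hi
  obtain ⟨j', hj', rfl⟩ := (sigma_bijOn N).surjOn hj
  rcases lt_trichotomy i' j' with h | h | h
  · exact key2 i' j' hi'.1 h hj'.2
  · exact absurd (congrArg _ h) hij
  · exact (key2 j' i' hj'.1 h hi'.2).symm


/-- The segment `[l, u]` splits into `[l, m]` and `[m', u]`, which are interchanged by `f`, and a
gap with a repelling fixed point `z`; on `[m, u]` the map is affine with slope `-b`. -/
structure Swap (f : ℝ → ℝ) (b z l m m' u : ℝ) : Prop where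
  cont : Continuous f
  one_lt : 1 < b
  l_lt : l < m
  m_lt : m < z
  lt_m' : z < m'
  lt_u : m' < u
  affine : ∀ x ∈ Icc m u, f x - z = -b * (x - z)
  mapsTo_left : MapsTo f (Icc l m) (Icc m' u)
  map_m' : f m' = m
  map_u : f u = l

/-- The second iterate of `f` with the orientation of the line reversed. -/
def flipSq (f : ℝ → ℝ) (y : ℝ) : ℝ := -f (f (-y))

theorem flipSq_iterate (f : ℝ → ℝ) (n : ℕ) (y : ℝ) : (flipSq f)^[n] y = -f^[2 * n] (-y) := by
  induction n with
  | zero => simp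
  | succ n ih =>
    rw [Function.iterate_succ_apply', ih, flipSq, neg_neg, show 2 * (n + 1) = 2 * n + 1 + 1 by ring,
      Function.iterate_succ_apply', Function.iterate_succ_apply']

/-- The inverse of the decreasing branch. -/
noncomputable def branch (b z w : ℝ) : ℝ := z - (w - z) / b

namespace Swap
variable {f : ℝ → ℝ} {b z l m m' u : ℝ} (S : Swap f b z l m m' u)
include S

theorem one_lt_abs : 1 < |-b| := by
  have := S.one_lt
  rwa [abs_neg, abs_of_pos (by linarith)]

theorem branch_le {v w : ℝ} (h : v ≤ w) : branch b z w ≤ branch b z v := by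
  unfold branch
  have := S.one_lt
  have : (v - z) / b ≤ (w - z) / b := by gcongr
  linarith

theorem branch_lt {v w : ℝ} (h : v < w) : branch b z w < branch b z v := by
  unfold branch
  have := S.one_lt
  have : (v - z) / b < (w - z) / b := by gcongr
  linarith

theorem branch_map {x : ℝ} (hx : x ∈ Icc m u) : branch b z (f x) = x := by
  unfold branch
  have := S.one_lt
  rw [S.affine x hx]
  field_simp
  ring

theorem right_subset : Icc m' u ⊆ Icc m u := Icc_subset_Icc_left (S.m_lt.trans S.lt_m').le

theorem left_subset : Icc l m ⊆ Icc l u :=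
  Icc_subset_Icc_right ((S.m_lt.trans S.lt_m').trans S.lt_u).le

theorem right_subset' : Icc m' u ⊆ Icc l u :=
  Icc_subset_Icc_left ((S.l_lt.trans S.m_lt).trans S.lt_m').le

theorem lt_of_mem {x y : ℝ} (hx : x ∈ Icc l m) (hy : y ∈ Icc m' u) : x < y :=
  (hx.2.trans_lt (S.m_lt.trans S.lt_m')).trans_le hy.1

theorem branch_m : branch b z m = m' := by
  have := S.branch_map (S.right_subset (left_mem_Icc.2 S.lt_u.le))
  rwa [S.map_m'] at this

theorem branch_l : branch b z l = u := by
  have := S.branch_map (S.right_subset (right_mem_Icc.2 S.lt_u.le))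
  rwa [S.map_u] at this

theorem branch_mem {w : ℝ} (hw : w ∈ Icc l m) : branch b z w ∈ Icc m' u := by
  rw [← S.branch_m, ← S.branch_l]
  exact ⟨S.branch_le hw.2, S.branch_le hw.1⟩

theorem map_branch {w : ℝ} (hw : w ∈ Icc l m) : f (branch b z w) = w := by
  have h1 := S.affine _ (S.right_subset (S.branch_mem hw))
  have := S.one_lt
  have h2 : -b * (branch b z w - z) = w - z := by
    unfold branch
    field_simp
    ring
  linarith

theorem anti {x y : ℝ} (hx : x ∈ Icc m u) (hy : y ∈ Icc m u) (hxy : x ≤ y) : f y ≤ f x := by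
  have h1 := S.affine x hx
  have h2 := S.affine y hy
  have := S.one_lt
  nlinarith

theorem mapsTo_right : MapsTo f (Icc m' u) (Icc l m) := by
  intro x hx
  have h0 := S.right_subset hx
  constructor
  · rw [← S.map_u]; exact S.anti h0 (S.right_subset (right_mem_Icc.2 S.lt_u.le)) hx.2
  · rw [← S.map_m']; exact S.anti (S.right_subset (left_mem_Icc.2 S.lt_u.le)) h0 hx.1

theorem map_z : f z = z := by
  have := S.affine z ⟨S.m_lt.le, (S.lt_m'.trans S.lt_u).le⟩
  linarith

theorem mapsTo : MapsTo f (Icc l u) (Icc l u) := by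
  intro x hx
  have h1 : m ∈ Icc m u := left_mem_Icc.2 ((S.m_lt.trans S.lt_m').trans S.lt_u).le
  have h2 : u ∈ Icc m u := right_mem_Icc.2 h1.2
  rcases le_total x m with h | h
  · exact S.right_subset' (S.mapsTo_left ⟨hx.1, h⟩)
  · refine ⟨?_, (S.anti h1 ⟨h, hx.2⟩ h).trans (S.mapsTo_left ⟨S.l_lt.le, le_rfl⟩).2⟩
    rw [← S.map_u]
    exact S.anti ⟨h, hx.2⟩ h2 hx.2

theorem iterate_even {x : ℝ} (hx : x ∈ Icc l m) (n : ℕ) : f^[2 * n] x ∈ Icc l m := by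
  induction n with
  | zero => exact hx
  | succ n ih =>
    rw [show 2 * (n + 1) = 2 * n + 1 + 1 by ring, Function.iterate_succ_apply',
      Function.iterate_succ_apply']
    exact S.mapsTo_right (S.mapsTo_left ih)

theorem iterate_odd {x : ℝ} (hx : x ∈ Icc l m) (n : ℕ) : f^[2 * n + 1] x ∈ Icc m' u := by
  rw [Function.iterate_succ_apply']
  exact S.mapsTo_left (S.iterate_even hx n)

omit S in
theorem neg_mem {x : ℝ} : -x ∈ Icc l m ↔ x ∈ Icc (-m) (-l) := by
  constructor <;> rintro ⟨h1, h2⟩ <;> constructor <;> linarith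

/-- Odd iterates move the left segment to the right one, so every period of a point on the left is
even. -/
theorem minimalPeriod_neg {x : ℝ} (hx : x ∈ Icc (-m) (-l)) :
    Function.minimalPeriod f (-x) = 2 * Function.minimalPeriod (flipSq f) x := by
  have hL : -x ∈ Icc l m := neg_mem.2 hx
  have hiff : ∀ n, Function.IsPeriodicPt (flipSq f) n x ↔ Function.IsPeriodicPt f (2 * n) (-x) := by
    intro n
    unfold Function.IsPeriodicPt Function.IsFixedPt
    rw [flipSq_iterate, neg_eq_iff_eq_neg]
  refine Nat.dvd_antisymm ?_ ?_
  · refine Function.IsPeriodicPt.minimalPeriod_dvd ((hiff _).1 ?_)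
    exact Function.isPeriodicPt_minimalPeriod _ _
  · have hp : Function.IsPeriodicPt f (Function.minimalPeriod f (-x)) (-x) :=
      Function.isPeriodicPt_minimalPeriod _ _
    rcases Nat.even_or_odd' (Function.minimalPeriod f (-x)) with ⟨k, hk | hk⟩
    · rw [hk] at hp ⊢
      exact Nat.mul_dvd_mul_left 2 ((hiff k).2 hp).minimalPeriod_dvd
    · rw [hk] at hp
      have h1 := S.iterate_odd hL k
      rw [show f^[2 * k + 1] (-x) = -x from hp] at h1
      exact absurd (S.lt_of_mem hL h1) (lt_irrefl _)

omit S in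
theorem mem_orbit_flipSq {x w : ℝ} (hw : w ∈ orbit (flipSq f) x) : -w ∈ orbit f (-x) := by
  obtain ⟨n, rfl⟩ := hw
  refine ⟨2 * n, ?_⟩
  simp only [flipSq_iterate, neg_neg]

theorem mem_orbit_iff {x w : ℝ} (hx : x ∈ Icc (-m) (-l)) (hw : w ∈ Icc l m) :
    w ∈ orbit f (-x) ↔ -w ∈ orbit (flipSq f) x := by
  constructor
  · rintro ⟨n, rfl⟩
    rcases Nat.even_or_odd' n with ⟨k, hk | hk⟩
    · refine ⟨k, ?_⟩
      simp only [flipSq_iterate, hk]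
    · have h1 := S.iterate_odd (neg_mem.2 hx) k
      simp only [hk] at hw
      exact absurd (S.lt_of_mem hw h1) (lt_irrefl _)
  · intro h
    have := mem_orbit_flipSq h
    rwa [neg_neg] at this

theorem unstable_neg {x : ℝ} (hx : x ∈ Icc (-m) (-l))
    (hu : ¬ IsStable (Icc (-m) (-l)) (flipSq f) (orbit (flipSq f) x)) :
    ¬ IsStable (Icc l u) f (orbit f (-x)) := by
  intro hs
  refine hu fun ε hε => ?_
  have hgap : 0 < m' - m := by linarith [S.m_lt, S.lt_m']
  -- A distance below the gap width m' - m forces the nearby orbit point to lie on the left, where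
  -- the orbit of f is the reflected orbit of `flipSq f`.
  obtain ⟨δ, hδ, h⟩ := hs (min ε (m' - m)) (lt_min hε hgap)
  refine ⟨δ, hδ, fun y hy hyO n => ?_⟩
  rw [Metric.infDist_lt_iff ⟨_, self_mem_orbit _ _⟩] at hyO ⊢
  obtain ⟨w, hw, hyw⟩ := hyO
  have hyL : -y ∈ Icc l m := neg_mem.2 hy
  have h1 := h (-y) (S.left_subset hyL) ((Metric.infDist_lt_iff ⟨_, self_mem_orbit _ _⟩).2
    ⟨-w, mem_orbit_flipSq hw, by rwa [dist_neg_neg]⟩) (2 * n)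
  obtain ⟨v, hv, hvd⟩ := (Metric.infDist_lt_iff ⟨_, self_mem_orbit _ _⟩).1 h1
  have hn := S.iterate_even hyL n
  rw [Real.dist_eq, lt_min_iff] at hvd
  have hvL : v ∈ Icc l m := by
    obtain ⟨k, rfl⟩ := hv
    rcases Nat.even_or_odd' k with ⟨j, rfl | rfl⟩
    · exact S.iterate_even (neg_mem.2 hx) j
    · have h2 := S.iterate_odd (neg_mem.2 hx) j
      have h3 := (abs_lt.1 hvd.2).1
      exact absurd h3 (by simp only; linarith [hn.2, h2.1])
  refine ⟨-v, (S.mem_orbit_iff hx hvL).1 hv, ?_⟩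
  rw [flipSq_iterate, dist_neg_neg, Real.dist_eq]
  exact hvd.1

theorem orbit_z : orbit f z = {z} := by
  ext w
  constructor
  · rintro ⟨n, rfl⟩
    exact Function.iterate_fixed S.map_z n
  · rintro rfl
    exact self_mem_orbit f _

-- Arbitrarily close to z there are points of the segment, and slope -b with b > 1 drives them out
-- of a fixed neighbourhood of z.
theorem unstable_z : ¬ IsStable (Icc l u) f (orbit f z) := by
  intro hs
  have h1 := S.m_lt
  have h2 := S.lt_m'
  have h3 := S.lt_u
  set ρ := min (z - m) (u - z) with hρ
  have hρpos : 0 < ρ := lt_min (by linarith) (by linarith)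
  obtain ⟨δ, hδ, h⟩ := hs ρ hρpos
  simp only [S.orbit_z, Metric.infDist_singleton, Real.dist_eq] at h
  have hη : 0 < min (δ / 2) (u - z) := lt_min (by linarith) (by linarith)
  obtain ⟨n, hn⟩ := exists_iterate_notMem (S := {v | |v - z| < ρ}) (f := f) S.one_lt_abs
    (fun v hv => le_of_lt hv)
    (fun v hv => by
      have hv' := abs_lt.1 (show |v - z| < ρ from hv)
      refine S.affine v ⟨?_, ?_⟩
      · linarith [min_le_left (z - m) (u - z)]
      · linarith [min_le_right (z - m) (u - z)])
    (x := z + min (δ / 2) (u - z)) (by linarith)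
  refine hn (h _ ⟨?_, ?_⟩ ?_ n)
  · linarith [S.l_lt]
  · linarith [min_le_right (δ / 2) (u - z)]
  · rw [add_sub_cancel_left, abs_of_pos hη]
    linarith [min_le_left (δ / 2) (u - z)]

/-- Every point except the fixed point enters the left segment. -/
theorem exists_iterate_mem_left {y : ℝ} (hy : y ∈ Icc l u) (hyz : y ≠ z) :
    ∃ n : ℕ, f^[n] y ∈ Icc l m := by
  obtain ⟨n, hn⟩ := exists_iterate_notMem (S := Ioo m m') (f := f) (ρ := u - l) S.one_lt_abs
    (fun v hv => by
      rw [abs_le]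
      constructor <;> linarith [S.l_lt, S.m_lt, S.lt_m', S.lt_u, hv.1, hv.2])
    (fun v hv => S.affine v ⟨hv.1.le, hv.2.le.trans S.lt_u.le⟩) hyz
  have h1 := S.mapsTo.iterate n hy
  rcases le_or_gt (f^[n] y) m with h2 | h2
  · exact ⟨n, h1.1, h2⟩
  · refine ⟨n + 1, ?_⟩
    rw [Function.iterate_succ_apply']
    exact S.mapsTo_right ⟨le_of_not_gt fun h3 => hn ⟨h2, h3⟩, h1.2⟩

theorem image_left {s t s' t' : ℝ} (hsub : Icc s t ⊆ Icc (-m) (-l))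
    (hsub' : Icc s' t' ⊆ Icc (-m) (-l)) (hst : s' ≤ t')
    (him : flipSq f '' Icc s t = Icc s' t') :
    f '' Icc (-t) (-s) = Icc (branch b z (-s')) (branch b z (-t')) := by
  have hs' := neg_mem.2 (hsub' (left_mem_Icc.2 hst))
  have ht' := neg_mem.2 (hsub' (right_mem_Icc.2 hst))
  ext w
  constructor
  · rintro ⟨v, hv, rfl⟩
    have hv' : -v ∈ Icc s t := ⟨by linarith [hv.2], by linarith [hv.1]⟩
    have hvL : v ∈ Icc l m := by
      have := neg_mem.2 (hsub hv')
      rwa [neg_neg] at this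
    have h1 : flipSq f (-v) ∈ Icc s' t' := him ▸ mem_image_of_mem _ hv'
    rw [flipSq, neg_neg] at h1
    rw [← S.branch_map (S.right_subset (S.mapsTo_left hvL))]
    exact ⟨S.branch_le (by linarith [h1.1]), S.branch_le (by linarith [h1.2])⟩
  · intro hw
    have hwR : w ∈ Icc m' u := ⟨(S.branch_mem hs').1.trans hw.1, hw.2.trans (S.branch_mem ht').2⟩
    have h1 := S.anti (S.right_subset (S.branch_mem hs')) (S.right_subset hwR) hw.1
    have h2 := S.anti (S.right_subset hwR) (S.right_subset (S.branch_mem ht')) hw.2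
    rw [S.map_branch hs'] at h1
    rw [S.map_branch ht'] at h2
    have h3 : -f w ∈ flipSq f '' Icc s t := by
      rw [him]
      constructor <;> linarith
    obtain ⟨v, hv, hvw⟩ := h3
    refine ⟨-v, ⟨by linarith [hv.2], by linarith [hv.1]⟩, ?_⟩
    rw [flipSq, neg_inj] at hvw
    have hR := S.mapsTo_left (neg_mem.2 (hsub hv))
    rw [← S.branch_map (S.right_subset hR), hvw, S.branch_map (S.right_subset hwR)]

theorem image_right {s t : ℝ} (hst : s ≤ t) (hsub : Icc s t ⊆ Icc (-m) (-l)) :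
    f '' Icc (branch b z (-s)) (branch b z (-t)) = Icc (-t) (-s) := by
  have hs := neg_mem.2 (hsub (left_mem_Icc.2 hst))
  have ht := neg_mem.2 (hsub (right_mem_Icc.2 hst))
  ext w
  constructor
  · rintro ⟨v, hv, rfl⟩
    have hvR : v ∈ Icc m' u := ⟨(S.branch_mem hs).1.trans hv.1, hv.2.trans (S.branch_mem ht).2⟩
    have h1 := S.anti (S.right_subset (S.branch_mem hs)) (S.right_subset hvR) hv.1
    have h2 := S.anti (S.right_subset hvR) (S.right_subset (S.branch_mem ht)) hv.2
    rw [S.map_branch hs] at h1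
    rw [S.map_branch ht] at h2
    exact ⟨h2, h1⟩
  · intro hw
    exact ⟨branch b z w, ⟨S.branch_le hw.2, S.branch_le hw.1⟩,
      S.map_branch ⟨ht.1.trans hw.1, hw.2.trans hs.2⟩⟩

end Swap

/-- The invariant set of `f` that corresponds to an invariant set of `flipSq f`. -/
noncomputable def double (b z : ℝ) (Λ : Set ℝ) : Set ℝ := {y | -y ∈ Λ} ∪ branch b z '' {y | -y ∈ Λ}

namespace Swap
variable {f : ℝ → ℝ} {b z l m m' u : ℝ} (S : Swap f b z l m m' u)
include S

section
variable {Λ : Set ℝ} (hΛ : Λ ⊆ Icc (-m) (-l)) (hinv : IsInvariant (flipSq f) Λ)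
include hΛ hinv

omit S hinv in
theorem left_of_neg_mem {y : ℝ} (hy : -y ∈ Λ) : y ∈ Icc l m := by
  have := neg_mem.2 (hΛ hy)
  rwa [neg_neg] at this

/-- Writing the right half of the doubled set as an f-image of the left half makes compactness,
density of periodic points and density of an orbit pass from left to right by continuity. -/
theorem branch_image_eq : branch b z '' {y | -y ∈ Λ} = f '' {y | -y ∈ Λ} := by
  ext w
  constructor
  · rintro ⟨v, hv, rfl⟩
    have hv1 : -v ∈ flipSq f '' Λ := by rw [show flipSq f '' Λ = Λ from hinv]; exact hv
    obtain ⟨y, hy, hyv⟩ := hv1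
    rw [flipSq, neg_inj] at hyv
    refine ⟨-y, by simpa using hy, ?_⟩
    rw [← hyv, S.branch_map (S.right_subset (S.mapsTo_left (neg_mem.2 (hΛ hy))))]
  · rintro ⟨v, hv, rfl⟩
    have hv1 : flipSq f (-v) ∈ Λ := by
      rw [← show flipSq f '' Λ = Λ from hinv]; exact mem_image_of_mem _ hv
    rw [flipSq, neg_neg] at hv1
    exact ⟨f (f v), hv1, S.branch_map (S.right_subset (S.mapsTo_left (left_of_neg_mem hΛ hv)))⟩

omit hinv in
theorem image_branch_image : f '' (branch b z '' {y | -y ∈ Λ}) = {y | -y ∈ Λ} := by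
  ext w
  constructor
  · rintro ⟨_, ⟨v, hv, rfl⟩, rfl⟩
    rwa [S.map_branch (left_of_neg_mem hΛ hv)]
  · intro hw
    exact ⟨_, ⟨w, hw, rfl⟩, S.map_branch (left_of_neg_mem hΛ hw)⟩

theorem image_double : f '' double b z Λ = double b z Λ := by
  unfold double
  rw [image_union, S.image_branch_image hΛ, ← S.branch_image_eq hΛ hinv, union_comm]

omit hinv in
theorem double_subset : double b z Λ ⊆ Icc l u := by
  rintro y (hy | ⟨v, hv, rfl⟩)
  · exact S.left_subset (left_of_neg_mem hΛ hy)
  · exact S.right_subset' (S.branch_mem (left_of_neg_mem hΛ hv))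

omit hinv in
theorem mem_double_left {y : ℝ} (hy : y ∈ Icc l m) : y ∈ double b z Λ ↔ -y ∈ Λ := by
  constructor
  · rintro (h | ⟨v, hv, rfl⟩)
    · exact h
    · exact absurd (S.lt_of_mem hy (S.branch_mem (left_of_neg_mem hΛ hv))) (lt_irrefl _)
  · exact fun h => Or.inl h

end

theorem isChaotic_double {Λ : Set ℝ} (hΛ : Λ ⊆ Icc (-m) (-l)) (hc : IsChaotic (flipSq f) Λ) :
    IsChaotic f (double b z Λ) := by
  have hinv := hc.invariant
  have him := S.image_double hΛ hinv
  have hLc : IsClosed {y | -y ∈ Λ} := hc.closed.preimage continuous_neg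
  have hLcomp : IsCompact {y | -y ∈ Λ} :=
    isCompact_Icc.of_isClosed_subset hLc fun y hy => left_of_neg_mem hΛ hy
  have hbr := S.branch_image_eq hΛ hinv
  have hmaps : MapsTo f (double b z Λ) (double b z Λ) := mapsTo_iff_image_subset.2 him.subset
  have hb := S.one_lt
  refine ⟨?_, him, ?_, ?_, ?_⟩
  · refine hLc.union ?_
    rw [hbr]
    exact (hLcomp.image S.cont).isClosed
  · -- density of the periodic points on the left, and then on the right by taking images
    have hleft : {y | -y ∈ Λ} ⊆ closure (double b z Λ ∩ Function.periodicPts f) := by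
      intro y hy
      rw [Metric.mem_closure_iff]
      intro ε hε
      obtain ⟨p, ⟨hp, k, hk, hpk⟩, hd⟩ := Metric.mem_closure_iff.1 (hc.dense_periodic hy) ε hε
      refine ⟨-p, ⟨Or.inl (by simpa using hp), 2 * k, by omega, ?_⟩, ?_⟩
      · have h1 : (flipSq f)^[k] p = p := hpk
        rw [flipSq_iterate, neg_eq_iff_eq_neg] at h1
        exact h1
      · rwa [← dist_neg_neg, neg_neg]
    rintro y (hy | hy)
    · exact hleft hy
    · rw [hbr] at hy
      obtain ⟨v, hv, rfl⟩ := hy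
      have h1 := image_closure_subset_closure_image S.cont (mem_image_of_mem f (hleft hv))
      refine closure_mono ?_ h1
      rintro _ ⟨p, ⟨hp, k, hk, hpk⟩, rfl⟩
      refine ⟨hmaps hp, k, hk, ?_⟩
      exact hpk.map (g := f) (fun _ => rfl)
  · obtain ⟨δ, hδ, hs⟩ := hc.sensitive
    have hleft : ∀ x, -x ∈ Λ → ∀ ε > 0, ∃ y, -y ∈ Λ ∧ |x - y| < ε ∧
        ∃ n : ℕ, δ < |f^[n] x - f^[n] y| := by
      intro x hx ε hε
      obtain ⟨y, hy, hxy, n, hn⟩ := hs (-x) hx ε hε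
      refine ⟨-y, by simpa using hy, ?_, 2 * n, ?_⟩
      · rwa [← abs_neg, show -(x - -y) = -x - y by ring]
      · rw [flipSq_iterate, flipSq_iterate, neg_neg] at hn
        rwa [← abs_neg, show -(f^[2 * n] x - f^[2 * n] (-y)) = -f^[2 * n] x - -f^[2 * n] (-y) by ring]
    refine ⟨δ, hδ, ?_⟩
    rintro x (hx | ⟨v, hv, rfl⟩) ε hε
    · obtain ⟨y, hy, h⟩ := hleft x hx ε hε
      exact ⟨y, Or.inl hy, h⟩
    · obtain ⟨y, hy, hvy, n, hn⟩ := hleft v hv ε hε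
      -- A pair on the left is pulled back by the inverse branch, which contracts by 1/b; one more
      -- iterate then reproduces the separation.
      refine ⟨branch b z y, Or.inr ⟨y, hy, rfl⟩, ?_, n + 1, ?_⟩
      · have h1 : branch b z v - branch b z y = -((v - y) / b) := by unfold branch; ring
        rw [h1, abs_neg, abs_div, abs_of_pos (by linarith : 0 < b)]
        exact (div_le_self (abs_nonneg _) hb.le).trans_lt hvy
      · rwa [Function.iterate_succ_apply, Function.iterate_succ_apply,
          S.map_branch (left_of_neg_mem hΛ hv), S.map_branch (left_of_neg_mem hΛ hy)]
  · obtain ⟨x, hx, hd⟩ := hc.dense_orbit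
    have hleft : {y | -y ∈ Λ} ⊆ closure (orbit f (-x)) := by
      intro y hy
      rw [Metric.mem_closure_iff]
      intro ε hε
      obtain ⟨w, hw, hyw⟩ := Metric.mem_closure_iff.1 (hd hy) ε hε
      refine ⟨-w, mem_orbit_flipSq hw, ?_⟩
      rwa [← dist_neg_neg, neg_neg]
    refine ⟨-x, Or.inl (by simpa using hx), ?_⟩
    rintro y (hy | hy)
    · exact hleft hy
    · rw [hbr] at hy
      obtain ⟨v, hv, rfl⟩ := hy
      have h1 := image_closure_subset_closure_image S.cont (mem_image_of_mem f (hleft hv))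
      refine closure_mono ?_ h1
      rintro _ ⟨_, ⟨n, rfl⟩, rfl⟩
      exact ⟨n + 1, Function.iterate_succ_apply' f n _⟩

end Swap

/-- The left ends of the intervals after the doubling of a cycle. -/
noncomputable def doubleA (b z : ℝ) (A B : ℕ → ℝ) (i : ℕ) : ℝ :=
  if Even i then -B ((i + 1) / 2) else branch b z (-A ((i + 1) / 2))

/-- The right ends of the intervals after the doubling of a cycle. -/
noncomputable def doubleB (b z : ℝ) (A B : ℕ → ℝ) (i : ℕ) : ℝ :=
  if Even i then -A ((i + 1) / 2) else branch b z (-B ((i + 1) / 2))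

/-- The points on the periodic orbits after the doubling of a cycle. -/
def doubleX (z : ℝ) (x : ℕ → ℝ) (i : ℕ) : ℝ := if i = 1 then z else -x (i - 1)

section
variable {b z : ℝ} {A B x : ℕ → ℝ}

theorem doubleA_even (j : ℕ) : doubleA b z A B (2 * j) = -B j := by
  rw [doubleA, if_pos (even_two_mul j), show (2 * j + 1) / 2 = j by omega]

theorem doubleB_even (j : ℕ) : doubleB b z A B (2 * j) = -A j := by
  rw [doubleB, if_pos (even_two_mul j), show (2 * j + 1) / 2 = j by omega]

theorem doubleA_odd (j : ℕ) : doubleA b z A B (2 * j + 1) = branch b z (-A (j + 1)) := by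
  rw [doubleA, if_neg (by simp), show (2 * j + 1 + 1) / 2 = j + 1 by omega]

theorem doubleB_odd (j : ℕ) : doubleB b z A B (2 * j + 1) = branch b z (-B (j + 1)) := by
  rw [doubleB, if_neg (by simp), show (2 * j + 1 + 1) / 2 = j + 1 by omega]

theorem doubleX_one : doubleX z x 1 = z := if_pos rfl

theorem doubleX_succ {i : ℕ} (hi : 1 ≤ i) : doubleX z x (i + 1) = -x i := by
  rw [doubleX, if_neg (by omega), Nat.add_sub_cancel]

end

theorem IntervalCycle.Icc_subset {f : ℝ → ℝ} {l u : ℝ} {N : ℕ} {A B x : ℕ → ℝ} {Λ : Set ℝ}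
    (hc : IntervalCycle f l u N A B x Λ) {i : ℕ} (h1 : 1 ≤ i) (h2 : i ≤ 2 ^ N) :
    Icc (A i) (B i) ⊆ Λ := by
  rw [hc.union]
  exact fun y hy => mem_biUnion (show i ∈ Icc 1 (2 ^ N) from ⟨h1, h2⟩) hy

/-- The reflected interval j receives index 2j and its preimage on the right index 2j - 1, so f runs
through the indices in turn: odd to even by the decreasing branch, even to the next odd because f²
realizes the old cycle. Reflection reverses the order on the left, while on the right the decreasing
branch restores it; this is the recursion of `sigma`. The old orbits move from index i to i + 1 with
doubled periods, and z becomes the first orbit. -/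
theorem Swap.intervalCycle_double {f : ℝ → ℝ} {b z l m m' u : ℝ} (S : Swap f b z l m m' u) {N : ℕ}
    {A B x : ℕ → ℝ} {Λ : Set ℝ} (hc : IntervalCycle (flipSq f) (-m) (-l) N A B x Λ) :
    IntervalCycle f l u (N + 1) (doubleA b z A B) (doubleB b z A B) (doubleX z x)
      (double b z Λ) := by
  have hΛ := hc.subset
  have hinv := hc.chaotic.invariant
  have hpow : 1 ≤ 2 ^ N := Nat.one_le_two_pow
  have hsub : ∀ i, 1 ≤ i → i ≤ 2 ^ N → Icc (A i) (B i) ⊆ Icc (-m) (-l) := fun i h1 h2 =>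
    (hc.Icc_subset h1 h2).trans hΛ
  have hlt : ∀ i, 1 ≤ i → i ≤ 2 ^ N → A i < B i := fun i h1 h2 => hc.lt i ⟨h1, h2⟩
  have hAL : ∀ i, 1 ≤ i → i ≤ 2 ^ N → -A i ∈ Icc l m := fun i h1 h2 =>
    neg_mem.2 (hsub i h1 h2 (left_mem_Icc.2 (hlt i h1 h2).le))
  have hBL : ∀ i, 1 ≤ i → i ≤ 2 ^ N → -B i ∈ Icc l m := fun i h1 h2 =>
    neg_mem.2 (hsub i h1 h2 (right_mem_Icc.2 (hlt i h1 h2).le))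
  have hxm : ∀ i ∈ Icc 1 N, x i ∈ Icc (-m) (-l) := fun i hi =>
    (hc.orbit_subset i hi (self_mem_orbit _ _)).1
  refine ⟨?_, ?_, S.double_subset hΛ, S.isChaotic_double hΛ hc.chaotic, ?_, ?_, ?_, ?_, ?_, ?_, ?_⟩
  · intro i hi
    simp only [mem_Icc, pow_succ] at hi
    rcases Nat.even_or_odd' i with ⟨j, rfl | rfl⟩
    · rw [doubleA_even, doubleB_even]
      linarith [hlt j (by omega) (by omega)]
    · rw [doubleA_odd, doubleB_odd]
      exact S.branch_lt (by linarith [hlt (j + 1) (by omega) (by omega)])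
  · ext y
    simp only [mem_iUnion, exists_prop, mem_Icc]
    constructor
    · rintro (hy | ⟨v, hv, rfl⟩)
      · have hy' : -y ∈ Λ := hy
        rw [hc.union] at hy'
        simp only [mem_iUnion, exists_prop, mem_Icc] at hy'
        obtain ⟨j, hj, hyj⟩ := hy'
        refine ⟨2 * j, ⟨by omega, by rw [pow_succ]; omega⟩, ?_⟩
        rw [doubleA_even, doubleB_even]
        constructor <;> linarith [hyj.1, hyj.2]
      · have hv' : -v ∈ Λ := hv
        rw [hc.union] at hv'
        simp only [mem_iUnion, exists_prop, mem_Icc] at hv'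
        obtain ⟨j, hj, hvj⟩ := hv'
        obtain ⟨j, rfl⟩ := Nat.exists_eq_add_of_le' hj.1
        refine ⟨2 * j + 1, ⟨by omega, by rw [pow_succ]; omega⟩, ?_⟩
        rw [doubleA_odd, doubleB_odd]
        exact ⟨S.branch_le (by linarith [hvj.1]), S.branch_le (by linarith [hvj.2])⟩
    · rintro ⟨i, hi, hy⟩
      rw [pow_succ] at hi
      rcases Nat.even_or_odd' i with ⟨j, rfl | rfl⟩
      · rw [doubleA_even, doubleB_even] at hy
        exact Or.inl (hc.Icc_subset (i := j) (by omega) (by omega)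
          ⟨by linarith [hy.2], by linarith [hy.1]⟩)
      · rw [doubleA_odd, doubleB_odd] at hy
        have h1 := S.image_right (hlt (j + 1) (by omega) (by omega)).le
          (hsub (j + 1) (by omega) (by omega))
        have h2 : f y ∈ Icc (-B (j + 1)) (-A (j + 1)) := h1 ▸ mem_image_of_mem f hy
        have hyR : y ∈ Icc m' u :=
          ⟨(S.branch_mem (hAL (j + 1) (by omega) (by omega))).1.trans hy.1,
            hy.2.trans (S.branch_mem (hBL (j + 1) (by omega) (by omega))).2⟩
        refine Or.inr ⟨f y, ?_, S.branch_map (S.right_subset hyR)⟩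
        exact hc.Icc_subset (i := j + 1) (by omega) (by omega)
          ⟨by linarith [h2.2], by linarith [h2.1]⟩
  · intro i h1 h2
    rw [pow_succ] at h2
    rcases Nat.even_or_odd' i with ⟨j, rfl | rfl⟩
    · rw [doubleA_even, doubleB_even, doubleA_odd, doubleB_odd]
      exact S.image_left (hsub j (by omega) (by omega)) (hsub (j + 1) (by omega) (by omega))
        (hlt (j + 1) (by omega) (by omega)).le (hc.map_succ j (by omega) (by omega))
    · rw [show 2 * j + 1 + 1 = 2 * (j + 1) by ring, doubleA_odd, doubleB_odd, doubleA_even,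
        doubleB_even]
      exact S.image_right (hlt (j + 1) (by omega) (by omega)).le
        (hsub (j + 1) (by omega) (by omega))
  · rw [pow_succ, mul_comm, doubleA_even, doubleB_even, show 1 = 2 * 0 + 1 by rfl, doubleA_odd,
      doubleB_odd]
    exact S.image_left (hsub _ hpow le_rfl) (hsub 1 le_rfl hpow) (hlt 1 le_rfl hpow).le hc.map_last
  · intro i h1 h2
    rw [pow_succ] at h2
    have hσ : ∀ j, 1 ≤ j → j ≤ 2 ^ N → 1 ≤ sigma N j ∧ sigma N j ≤ 2 ^ N := fun j h1 h2 =>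
      ⟨sigma_pos N j h1 h2, sigma_le N j h1 h2⟩
    have hleft : ∀ j, j ≤ 2 ^ N → sigma (N + 1) j = 2 * sigma N (2 ^ N + 1 - j) := by
      intro j hj
      rw [sigma, if_neg (by omega)]
    have hright : ∀ j, 1 ≤ j → j ≤ 2 ^ N →
        sigma (N + 1) (2 ^ N + j) = 2 * (sigma N j - 1) + 1 := by
      intro j hj1 hj2
      have := (hσ j hj1 hj2).1
      rw [sigma, if_pos (by omega), Nat.add_sub_cancel_left]
      omega
    -- Neighbours within the left half, the pair on the two sides of the gap, and neighbours within
    -- the right half. The middle pair comes from one old interval, of index σ_N(1).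
    rcases lt_trichotomy i (2 ^ N) with h | h | h
    · rw [hleft i h.le, hleft (i + 1) h, doubleB_even, doubleA_even]
      have h3 := hc.order (2 ^ N - i) (by omega) (by omega)
      rw [show 2 ^ N + 1 - (i + 1) = 2 ^ N - i by omega,
        show 2 ^ N + 1 - i = 2 ^ N - i + 1 by omega]
      linarith
    · subst h
      have h3 := hσ 1 le_rfl hpow
      rw [hleft _ le_rfl, hright 1 le_rfl hpow, Nat.add_sub_cancel_left, doubleB_even, doubleA_odd,
        Nat.sub_add_cancel h3.1]
      exact S.lt_of_mem (hAL _ h3.1 h3.2) (S.branch_mem (hAL _ h3.1 h3.2))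
    · obtain ⟨t, rfl⟩ := Nat.exists_eq_add_of_le h.le
      have h3 := hc.order t (by omega) (by omega)
      have h4 := hσ t (by omega) (by omega)
      have h5 := hσ (t + 1) (by omega) (by omega)
      rw [hright t (by omega) (by omega), add_assoc, hright (t + 1) (by omega) (by omega),
        doubleB_odd, doubleA_odd, Nat.sub_add_cancel h4.1, Nat.sub_add_cancel h5.1]
      exact S.branch_lt (by linarith)
  · intro i hi
    obtain ⟨i, rfl⟩ := Nat.exists_eq_add_of_le' hi.1
    rcases Nat.eq_zero_or_pos i with rfl | h
    · rw [zero_add, doubleX_one]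
      simpa using Function.minimalPeriod_eq_one_iff_isFixedPt.2 S.map_z
    · have hi' : i ∈ Icc 1 N := ⟨h, by have := hi.2; omega⟩
      rw [doubleX_succ h, S.minimalPeriod_neg (hxm i hi'), hc.minimalPeriod i hi', ← pow_succ']
      congr 1
      omega
  · intro i hi
    obtain ⟨i, rfl⟩ := Nat.exists_eq_add_of_le' hi.1
    rcases Nat.eq_zero_or_pos i with rfl | h
    · rw [zero_add, doubleX_one, S.orbit_z]
      rintro _ rfl
      refine ⟨⟨(S.l_lt.trans S.m_lt).le, (S.lt_m'.trans S.lt_u).le⟩, ?_⟩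
      rintro (h | ⟨v, hv, h⟩)
      · exact absurd (left_of_neg_mem hΛ h).2 (not_le.2 S.m_lt)
      · have := (S.branch_mem (left_of_neg_mem hΛ hv)).1
        rw [h] at this
        exact absurd this (not_le.2 S.lt_m')
    · have hi' : i ∈ Icc 1 N := ⟨h, by have := hi.2; omega⟩
      rw [doubleX_succ h]
      have hL := neg_mem.2 (hxm i hi')
      have hne : ∀ k, f^[2 * k] (-x i) ∉ double b z Λ := by
        intro k hk
        rw [S.mem_double_left hΛ (S.iterate_even hL k), ← flipSq_iterate] at hk
        exact (hc.orbit_subset i hi' ⟨k, rfl⟩).2 hk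
      rintro _ ⟨n, rfl⟩
      refine ⟨S.mapsTo.iterate n (S.left_subset hL), fun hn => ?_⟩
      rcases Nat.even_or_odd' n with ⟨k, rfl | rfl⟩
      · exact hne k hn
      -- Invariance of the doubled set would put the next, even, iterate into it as well.
      · refine hne (k + 1) ?_
        rw [show 2 * (k + 1) = 2 * k + 1 + 1 by ring, Function.iterate_succ_apply',
          ← S.image_double hΛ hinv]
        exact mem_image_of_mem f hn
  · intro i hi
    obtain ⟨i, rfl⟩ := Nat.exists_eq_add_of_le' hi.1
    rcases Nat.eq_zero_or_pos i with rfl | h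
    · rw [zero_add, doubleX_one]
      exact S.unstable_z
    · have hi' : i ∈ Icc 1 N := ⟨h, by have := hi.2; omega⟩
      rw [doubleX_succ h]
      exact S.unstable_neg (hxm i hi') (hc.unstable i hi')
  · intro y hy h1 h2
    have hyz : y ≠ z := by
      rintro rfl
      refine h1 1 ⟨le_rfl, by omega⟩ ?_
      rw [doubleX_one]
      exact self_mem_orbit f _
    obtain ⟨n, hn⟩ := S.exists_iterate_mem_left hy hyz
    -- Because of the index shift, avoiding the new orbits 2, …, N + 1 means avoiding all the old
    -- ones, including the first.
    have havoid : ∀ i ∈ Icc 1 N, ∀ k : ℕ,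
        (flipSq f)^[k] (-f^[n] y) ∉ orbit (flipSq f) (x i) := by
      intro i hi k hk
      refine h2 (i + 1) ⟨by have := hi.1; omega, by have := hi.2; omega⟩ (2 * k + n) ?_
      rw [doubleX_succ hi.1, Function.iterate_add_apply,
        S.mem_orbit_iff (hxm i hi) (S.iterate_even hn k)]
      rwa [flipSq_iterate, neg_neg] at hk
    obtain ⟨k, hk⟩ := hc.absorb (-f^[n] y) (neg_mem.1 (by rwa [neg_neg]))
      (fun i hi => havoid i hi 0)
      (fun i hi => havoid i ⟨(by decide : 1 ≤ 2).trans hi.1, hi.2⟩)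
    refine ⟨2 * k + n, Or.inl ?_⟩
    rwa [flipSq_iterate, neg_neg, ← Function.iterate_add_apply] at hk

/-! ### Renormalization of the skew tent map -/

namespace TentParam
variable {a b h r : ℝ} (P : TentParam a b h)
include P

/-- The parameters of the renormalized map. -/
theorem renormalize (hn : a * b ^ 2 < a + b) : TentParam (b ^ 2) (a * b) ((b - 1) * h) := by
  have ha := P.one_lt_a
  have hb := P.one_lt_b
  refine ⟨by nlinarith, by nlinarith, mul_pos (by linarith) P.h_pos, ?_⟩
  nlinarith

/-- With l and u the ends of the core, the inner ends are forced: m' = f(l) and m = f(m'). Both m <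
z and z < m' reduce to ab² < a + b. -/
theorem swap (hn : a * b ^ 2 < a + b) :
    Swap (tent a b r h) b (r + h / (1 + b)) (r + h - b * h) (r + (a * b - 1) * (b - 1) * h)
      (r + h - a * (b - 1) * h) (r + h) := by
  have ha := P.one_lt_a
  have hb := P.one_lt_b
  have hh := P.h_pos
  have hab : 1 < a * b := by nlinarith
  have hz : h / (1 + b) * (1 + b) = h := by field_simp
  have hm : r < r + (a * b - 1) * (b - 1) * h := by
    have := mul_pos (mul_pos (sub_pos.2 hab) (sub_pos.2 hb)) hh
    linarith
  have hmz : (a * b - 1) * (b - 1) * h < h / (1 + b) := by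
    rw [lt_div_iff₀ (by linarith)]
    have : (a * b - 1) * (b - 1) * (1 + b) < 1 := by nlinarith
    nlinarith
  have hzm : h / (1 + b) < h - a * (b - 1) * h := by
    rw [div_lt_iff₀ (by linarith)]
    have : 1 < (1 - a * (b - 1)) * (1 + b) := by nlinarith
    nlinarith
  have hzpos : 0 < h / (1 + b) := by positivity
  refine ⟨continuous_tent, hb, ?_, by linarith, by linarith, ?_, ?_, ?_, ?_, P.tent_top⟩
  · have := P.low_lt (r := r)
    linarith
  · have := mul_pos (mul_pos (by linarith : 0 < a) (sub_pos.2 hb)) hh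
    linarith
  · intro x hx
    rw [P.right (hm.le.trans hx.1)]
    linear_combination -hz
  · intro x hx
    refine ⟨?_, tent_le P.a_nonneg P.b_nonneg x⟩
    rcases le_total x r with h1 | h1
    · rw [P.left h1]
      nlinarith [hx.1]
    · rw [P.right h1]
      have h2 : b * (x - r) ≤ b * ((a * b - 1) * (b - 1) * h) :=
        mul_le_mul_of_nonneg_left (by linarith [hx.2]) (by linarith)
      have h3 : b * ((a * b - 1) * (b - 1) * h) ≤ a * ((b - 1) * h) := by
        have h4 : 0 < (b - 1) * h := mul_pos (by linarith) hh
        nlinarith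
      linarith
  · rw [P.right (by linarith)]
    ring

/-- The flipped second iterate is again a skew tent map near the turning point. -/
theorem flipSq_tent (hn : a * b ^ 2 < a + b) :
    EqOn (flipSq (tent a b r h)) (tent (b ^ 2) (a * b) (-r) ((b - 1) * h))
      (Icc (-(r + (a * b - 1) * (b - 1) * h)) (-(r + h - b * h))) := by
  intro y hy
  have S := P.swap (r := r) hn
  have P' := P.renormalize hn
  have hzr : 0 < h / (1 + b) := div_pos P.h_pos (by linarith [P.one_lt_b])
  -- The first image of the left segment lies to the right of r, so the second step always uses the
  -- decreasing branch. Thus f² has a valley at r, which the reflection turns into a peak.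
  have h1 := S.mapsTo_left (Swap.neg_mem.2 hy)
  have h2 : r ≤ tent a b r h (-y) := by linarith [h1.1, S.lt_m']
  rw [flipSq, P.right h2]
  rcases le_total y (-r) with h3 | h3
  · rw [P'.left h3, P.right (by linarith)]
    ring
  · rw [P'.right h3, P.left (by linarith)]
    ring

theorem exists_intervalCycle_of_le (hn : a + b ≤ a * b ^ 2) :
    ∃ N A B x Λ, IntervalCycle (tent a b r h) (r + h - b * h) (r + h) N A B x Λ := by
  refine ⟨0, fun _ => r + h - b * h, fun _ => r + h, fun _ => 0, Icc (r + h - b * h) (r + h), ?_,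
    ?_, subset_rfl, P.isChaotic_core hn, ?_, P.image_core, ?_, ?_, ?_, ?_, fun y hy _ _ => ⟨0, hy⟩⟩
  · intro _ _
    nlinarith [P.one_lt_b, P.h_pos]
  · simp
  all_goals
    intro i
    first
    | intro h1 h2; rw [pow_zero] at h2; omega
    | intro hi; exact absurd (hi.1.trans hi.2) (by decide)

end TentParam

/-- Induction on a bound for the number of renormalizations. Each replaces b by ab ≥ μb and keeps
both slopes at least μ; once b ≥ 2, the inequality a + b ≤ ab² is automatic. -/
theorem exists_intervalCycle_aux {μ : ℝ} (hμ : 1 < μ) (n : ℕ) : ∀ a b r h : ℝ, TentParam a b h →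
    μ ≤ a → μ ≤ b → 2 ≤ b * μ ^ n →
    ∃ N A B x Λ, IntervalCycle (tent a b r h) (r + h - b * h) (r + h) N A B x Λ := by
  induction n with
  | zero =>
    intro a b r h P _ _ hb2
    have hn : a + b ≤ a * b ^ 2 := by
      rw [pow_zero, mul_one] at hb2
      have := P.one_lt_a
      have := P.one_lt_b
      nlinarith [mul_nonneg (sub_nonneg.2 hb2) (sub_nonneg.2 P.one_lt_a.le)]
    exact P.exists_intervalCycle_of_le hn
  | succ n ih =>
    intro a b r h P ha hb hbn
    by_cases hn : a + b ≤ a * b ^ 2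
    · exact P.exists_intervalCycle_of_le hn
    · push Not at hn
      have P' := P.renormalize hn
      have S := P.swap (r := r) hn
      have h1 := P.one_lt_a
      have h2 := P.one_lt_b
      obtain ⟨N, A, B, x, Λ, hc⟩ := ih (b ^ 2) (a * b) (-r) ((b - 1) * h) P' (by nlinarith)
        (by nlinarith) (by
          refine hbn.trans ?_
          rw [pow_succ]
          have h3 : 0 < μ ^ n := by positivity
          have h4 : b * μ ≤ a * b := by nlinarith
          nlinarith [mul_le_mul_of_nonneg_right h4 h3.le])
      rw [show -r + (b - 1) * h - a * b * ((b - 1) * h) = -(r + (a * b - 1) * (b - 1) * h) by ring,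
        show -r + (b - 1) * h = -(r + h - b * h) by ring] at hc
      have hm := P'.mapsTo (r := -r)
      rw [show -r + (b - 1) * h - a * b * ((b - 1) * h) = -(r + (a * b - 1) * (b - 1) * h) by ring,
        show -r + (b - 1) * h = -(r + h - b * h) by ring] at hm
      exact ⟨_, _, _, _, _, S.intervalCycle_double (hc.congr (P.flipSq_tent hn) hm)⟩

/-- Every expanding skew tent map has a chaotic cycle of intervals in its core. -/
theorem TentParam.exists_intervalCycle {a b h r : ℝ} (P : TentParam a b h) :
    ∃ N A B x Λ, IntervalCycle (tent a b r h) (r + h - b * h) (r + h) N A B x Λ := by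
  have hμ : 1 < min a b := lt_min P.one_lt_a P.one_lt_b
  obtain ⟨n, hn⟩ := pow_unbounded_of_one_lt 2 hμ
  refine exists_intervalCycle_aux hμ n a b r h P (min_le_left _ _) (min_le_right _ _) ?_
  have := P.one_lt_b
  nlinarith


/-! ### Expanding maps with two full branches -/

/-- The map `f` expands the segments `[e, u]` and `[v, c]` at least `μ` times and maps each of them
over the whole segment `[e, c]`; the points of the gap leave `[e, c]`. -/
structure Horseshoe (f : ℝ → ℝ) (μ e u v c : ℝ) : Prop where
  cont : Continuous f
  one_lt : 1 < μ
  u_lt : u < v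
  e_le : e ≤ u
  le_c : v ≤ c
  surj_left : SurjOn f (Icc e u) (Icc e c)
  surj_right : SurjOn f (Icc v c) (Icc e c)
  expand_left : ∀ x ∈ Icc e u, ∀ y ∈ Icc e u, μ * |x - y| ≤ |f x - f y|
  expand_right : ∀ x ∈ Icc v c, ∀ y ∈ Icc v c, μ * |x - y| ≤ |f x - f y|
  split : ∀ x ∈ Icc e c, f x ∈ Icc e c → x ∈ Icc e u ∨ x ∈ Icc v c

/-- The points whose trajectories stay in the segment `[e, c]`. -/
def staying (f : ℝ → ℝ) (e c : ℝ) : Set ℝ := {x | ∀ n : ℕ, f^[n] x ∈ Icc e c}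

/-- The itinerary of a point with respect to the partition at `v`. -/
noncomputable def itinerary (f : ℝ → ℝ) (v x : ℝ) (n : ℕ) : Bool := by
  classical exact decide (v ≤ f^[n] x)

theorem itinerary_eq_true {f : ℝ → ℝ} {v x : ℝ} {n : ℕ} :
    itinerary f v x n = true ↔ v ≤ f^[n] x := by simp [itinerary]

theorem itinerary_iterate (f : ℝ → ℝ) (v x : ℝ) (m n : ℕ) :
    itinerary f v (f^[m] x) n = itinerary f v x (n + m) := by
  rw [itinerary, itinerary, Function.iterate_add_apply]

theorem iterate_mem_staying {f : ℝ → ℝ} {e c x : ℝ} (hx : x ∈ staying f e c) (m : ℕ) :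
    f^[m] x ∈ staying f e c := by
  intro n
  rw [← Function.iterate_add_apply]
  exact hx (n + m)

theorem mapsTo_staying (f : ℝ → ℝ) (e c : ℝ) : MapsTo f (staying f e c) (staying f e c) :=
  fun _ hx => iterate_mem_staying hx 1

namespace Horseshoe
variable {f : ℝ → ℝ} {μ e u v c : ℝ} (H : Horseshoe f μ e u v c)
include H

theorem isCompact_staying : IsCompact (staying f e c) := by
  have h1 : staying f e c = ⋂ n : ℕ, f^[n] ⁻¹' Icc e c := by
    ext x; simp [staying]
  refine isCompact_Icc.of_isClosed_subset ?_ (fun x hx => hx 0)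
  rw [h1]
  exact isClosed_iInter fun n => isClosed_Icc.preimage (H.cont.iterate n)

theorem split_iterate {x : ℝ} (hx : x ∈ staying f e c) (n : ℕ) :
    f^[n] x ∈ Icc e u ∨ f^[n] x ∈ Icc v c := by
  refine H.split _ (hx n) ?_
  rw [← Function.iterate_succ_apply' f n x]
  exact hx (n + 1)

theorem itinerary_eq_false {x : ℝ} (hx : x ∈ staying f e c) {n : ℕ} :
    itinerary f v x n = false ↔ f^[n] x ≤ u := by
  rw [← Bool.not_eq_true, itinerary_eq_true]
  rcases H.split_iterate hx n with h | h
  · exact ⟨fun _ => h.2, fun _ => not_le.2 (h.2.trans_lt H.u_lt)⟩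
  · exact ⟨fun h1 => absurd h.1 h1, fun h1 => absurd (h.1.trans h1) (not_le.2 H.u_lt)⟩

/-- As long as the itineraries agree both points are in the same piece, where f expands by μ, and
the distance never exceeds c - e. -/
theorem pow_mul_le {x y : ℝ} (hx : x ∈ staying f e c) (hy : y ∈ staying f e c) {n : ℕ}
    (h : ∀ i < n, itinerary f v x i = itinerary f v y i) : μ ^ n * |x - y| ≤ c - e := by
  have key : μ ^ n * |x - y| ≤ |f^[n] x - f^[n] y| := by
    induction n with
    | zero => simp
    | succ n ih =>
      have h1 := ih fun i hi => h i (by omega)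
      have h2 : μ * |f^[n] x - f^[n] y| ≤ |f (f^[n] x) - f (f^[n] y)| := by
        have h3 := h n (by omega)
        rcases hs : itinerary f v x n with _ | _
        · rw [hs] at h3
          exact H.expand_left _ ⟨(hx n).1, (H.itinerary_eq_false hx).1 hs⟩ _
            ⟨(hy n).1, (H.itinerary_eq_false hy).1 h3.symm⟩
        · rw [hs] at h3
          exact H.expand_right _ ⟨itinerary_eq_true.1 hs, (hx n).2⟩ _
            ⟨itinerary_eq_true.1 h3.symm, (hy n).2⟩
      rw [Function.iterate_succ_apply', Function.iterate_succ_apply', pow_succ', mul_assoc]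
      exact (mul_le_mul_of_nonneg_left h1 (by linarith [H.one_lt])).trans h2
  refine key.trans ?_
  rw [abs_le]
  constructor <;> linarith [(hx n).1, (hx n).2, (hy n).1, (hy n).2]

/-- Points with a long common piece of the itineraries are close. -/
theorem exists_near {ε : ℝ} (hε : 0 < ε) : ∃ n : ℕ, ∀ x ∈ staying f e c, ∀ y ∈ staying f e c,
    (∀ i < n, itinerary f v x i = itinerary f v y i) → |x - y| < ε := by
  obtain ⟨n, hn⟩ := pow_unbounded_of_one_lt ((c - e) / ε) H.one_lt
  refine ⟨n, fun x hx y hy h => ?_⟩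
  have h1 := H.pow_mul_le hx hy h
  rw [div_lt_iff₀ hε] at hn
  have h2 : 0 < μ ^ n := pow_pos (by linarith [H.one_lt]) n
  exact lt_of_mul_lt_mul_left (h1.trans_lt hn) h2.le

theorem eq_of_itinerary_eq {x y : ℝ} (hx : x ∈ staying f e c) (hy : y ∈ staying f e c)
    (h : itinerary f v x = itinerary f v y) : x = y := by
  by_contra hne
  obtain ⟨n, hn⟩ := H.exists_near (abs_pos.2 (sub_ne_zero.2 hne))
  exact lt_irrefl _ (hn x hx y hy fun i _ => congrFun h i)

/-- Each piece covers [e, c], so finite words are realized by induction, pulling back a point that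
realizes the shifted word; compactness of the nested sets C s n gives infinite words. -/
theorem exists_itinerary (s : ℕ → Bool) : ∃ x ∈ staying f e c, ∀ n, itinerary f v x n = s n := by
  set seg : Bool → Set ℝ := fun t => if t then Icc v c else Icc e u with hseg
  have hsub : ∀ t, seg t ⊆ Icc e c := by
    rintro (_ | _)
    · exact Icc_subset_Icc_right (H.u_lt.le.trans H.le_c)
    · exact Icc_subset_Icc_left (H.e_le.trans H.u_lt.le)
  have hclosed : ∀ t, IsClosed (seg t) := by
    rintro (_ | _)
    · exact isClosed_Icc
    · exact isClosed_Icc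
  have hsurj : ∀ t, SurjOn f (seg t) (Icc e c) := by
    rintro (_ | _)
    · exact H.surj_left
    · exact H.surj_right
  let C : (ℕ → Bool) → ℕ → Set ℝ := fun s n => Icc e c ∩ ⋂ i < n, f^[i] ⁻¹' seg (s i)
  have hmem : ∀ s n x, x ∈ C s n ↔ x ∈ Icc e c ∧ ∀ i < n, f^[i] x ∈ seg (s i) := by
    intro s n x
    simp [C]
  have hne : ∀ n s, (C s n).Nonempty := by
    intro n
    induction n with
    | zero =>
      exact fun s => ⟨e, (hmem _ _ _).2 ⟨left_mem_Icc.2 (H.e_le.trans (H.u_lt.le.trans H.le_c)),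
        fun i hi => absurd hi (Nat.not_lt_zero i)⟩⟩
    | succ n ih =>
      intro s
      obtain ⟨y, hy⟩ := ih fun i => s (i + 1)
      rw [hmem] at hy
      obtain ⟨x, hx, rfl⟩ := hsurj (s 0) hy.1
      refine ⟨x, (hmem _ _ _).2 ⟨hsub _ hx, ?_⟩⟩
      rintro (_ | i) hi
      · exact hx
      · exact hy.2 i (by omega)
  have hCclosed : ∀ n, IsClosed (C s n) := fun n =>
    isClosed_Icc.inter (isClosed_biInter fun i _ => (hclosed _).preimage (H.cont.iterate i))
  obtain ⟨x, hx⟩ := IsCompact.nonempty_iInter_of_sequence_nonempty_isCompact_isClosed (C s)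
    (fun n x hx => by
      rw [hmem] at hx ⊢
      exact ⟨hx.1, fun i hi => hx.2 i (by omega)⟩)
    (fun n => hne n s)
    (isCompact_Icc.of_isClosed_subset (hCclosed 0) fun x hx => ((hmem _ _ _).1 hx).1) hCclosed
  have hx' : ∀ n, f^[n] x ∈ seg (s n) := fun n =>
    ((hmem _ _ _).1 (mem_iInter.1 hx (n + 1))).2 n (by omega)
  have hst : x ∈ staying f e c := fun n => hsub _ (hx' n)
  refine ⟨x, hst, fun n => ?_⟩
  have h1 := hx' n
  rcases hs : s n with _ | _
  · rw [hs] at h1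
    exact (H.itinerary_eq_false hst).2 h1.2
  · rw [hs] at h1
    exact itinerary_eq_true.2 h1.1

theorem exists_homeomorph : ∃ φ : staying f e c ≃ₜ (ℕ → Bool), ∀ x, φ x = itinerary f v x := by
  have hbij : Function.Bijective fun x : staying f e c => itinerary f v (x : ℝ) := by
    constructor
    · intro x y hxy
      exact Subtype.ext (H.eq_of_itinerary_eq x.2 y.2 hxy)
    · intro s
      obtain ⟨x, hx, hs⟩ := H.exists_itinerary s
      exact ⟨⟨x, hx⟩, funext hs⟩
  -- For staying points the conditions v ≤ f^n x and u < f^n x are equivalent because of the gap, so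
  -- each symbol is a clopen condition.
  have hcont : Continuous fun x : staying f e c => itinerary f v (x : ℝ) := by
    refine continuous_pi fun n => ?_
    have hn : Continuous fun x : staying f e c => f^[n] (x : ℝ) :=
      (H.cont.iterate n).comp continuous_subtype_val
    refine (continuous_bool_rng true).2 ⟨?_, ?_⟩
    · have : ((fun x : staying f e c => itinerary f v (x : ℝ) n) ⁻¹' {true}) =
          {x : staying f e c | v ≤ f^[n] (x : ℝ)} := by
        ext x; exact itinerary_eq_true
      rw [this]
      exact isClosed_le continuous_const hn
    · have : ((fun x : staying f e c => itinerary f v (x : ℝ) n) ⁻¹' {true}) =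
          {x : staying f e c | u < f^[n] (x : ℝ)} := by
        ext x
        change itinerary f v x n = true ↔ u < f^[n] x
        rw [← not_le, ← H.itinerary_eq_false x.2, Bool.not_eq_false]
      rw [this]
      exact isOpen_lt continuous_const hn
  have : CompactSpace (staying f e c) := isCompact_iff_compactSpace.1 H.isCompact_staying
  exact ⟨Continuous.homeoOfEquivCompactToT2 (f := Equiv.ofBijective _ hbij) hcont, fun _ => rfl⟩

theorem conjugateToShift : ConjugateToShift f (staying f e c) := by
  obtain ⟨φ, hφ⟩ := H.exists_homeomorph
  refine ⟨mapsTo_staying f e c, φ, fun x => ?_⟩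
  rw [hφ, hφ]
  funext n
  exact itinerary_iterate f v x 1 n

/-- Near every point there are points which are eventually separated from it. -/
theorem exists_separated {x : ℝ} (hx : x ∈ staying f e c) {ε : ℝ} (hε : 0 < ε) :
    ∃ y ∈ staying f e c, |x - y| < ε ∧ ∃ n : ℕ, v - u ≤ |f^[n] x - f^[n] y| := by
  obtain ⟨n, hn⟩ := H.exists_near hε
  -- The symbols of x are copied for n steps and then inverted, so that at time n the two points lie
  -- on different sides of the gap.
  obtain ⟨y, hy, hys⟩ := H.exists_itinerary
    fun i => if i < n then itinerary f v x i else !itinerary f v x i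
  refine ⟨y, hy, hn x hx y hy fun i hi => by rw [hys, if_pos hi], n, ?_⟩
  have h1 : itinerary f v y n = !itinerary f v x n := by rw [hys, if_neg (lt_irrefl n)]
  rcases hs : itinerary f v x n with _ | _
  · rw [hs] at h1
    have h2 := (H.itinerary_eq_false hx).1 hs
    have h3 := itinerary_eq_true.1 h1
    rw [abs_sub_comm]
    exact (by linarith : v - u ≤ f^[n] y - f^[n] x).trans (le_abs_self _)
  · rw [hs] at h1
    have h2 := (H.itinerary_eq_false hy).1 h1
    have h3 := itinerary_eq_true.1 hs
    exact (by linarith : v - u ≤ f^[n] x - f^[n] y).trans (le_abs_self _)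

theorem nonempty_staying : (staying f e c).Nonempty :=
  let ⟨x, hx, _⟩ := H.exists_itinerary fun _ => false
  ⟨x, hx⟩

theorem isCantorSet : IsCantorSet (staying f e c) := by
  obtain ⟨φ, -⟩ := H.exists_homeomorph
  refine ⟨H.nonempty_staying, H.isCompact_staying, ⟨H.isCompact_staying.isClosed, ?_⟩, ?_⟩
  · intro x hx
    rw [accPt_iff_nhds]
    intro U hU
    obtain ⟨ε, hε, hball⟩ := Metric.mem_nhds_iff.1 hU
    obtain ⟨y, hy, hxy, n, hn⟩ := H.exists_separated hx hε
    refine ⟨y, ⟨hball ?_, hy⟩, ?_⟩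
    · rwa [Metric.mem_ball, dist_comm, Real.dist_eq]
    · rintro rfl
      rw [sub_self, abs_zero] at hn
      linarith [H.u_lt]
  · rw [← totallyDisconnectedSpace_subtype_iff]
    exact φ.symm.totallyDisconnectedSpace

theorem isChaotic : IsChaotic f (staying f e c) := by
  have hmaps := mapsTo_staying f e c
  refine ⟨H.isCompact_staying.isClosed, ?_, ?_, ?_, ?_⟩
  · refine (mapsTo_iff_image_subset.1 hmaps).antisymm fun y hy => ?_
    obtain ⟨x, hx, hxs⟩ := H.exists_itinerary fun n => if n = 0 then true else itinerary f v y (n - 1)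
    refine ⟨x, hx, H.eq_of_itinerary_eq (hmaps hx) hy (funext fun n => ?_)⟩
    rw [show f x = f^[1] x from rfl, itinerary_iterate, hxs, if_neg n.succ_ne_zero,
      Nat.add_sub_cancel]
  · intro x hx
    rw [Metric.mem_closure_iff]
    intro ε hε
    obtain ⟨n, hn⟩ := H.exists_near hε
    -- The first n + 1 symbols are repeated periodically; the length n + 1 keeps the period positive
    -- when n = 0.
    obtain ⟨y, hy, hys⟩ := H.exists_itinerary fun i => itinerary f v x (i % (n + 1))
    refine ⟨y, ⟨hy, n + 1, n.succ_pos, ?_⟩, ?_⟩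
    · refine H.eq_of_itinerary_eq (iterate_mem_staying hy _) hy (funext fun i => ?_)
      rw [itinerary_iterate, hys, hys, Nat.add_mod_right]
    · rw [Real.dist_eq]
      exact hn x hx y hy fun i hi => by rw [hys, Nat.mod_eq_of_lt (by omega)]
  · refine ⟨(v - u) / 2, by linarith [H.u_lt], fun x hx ε hε => ?_⟩
    obtain ⟨y, hy, hxy, n, hn⟩ := H.exists_separated hx hε
    exact ⟨y, hy, hxy, n, by linarith [H.u_lt]⟩
  · refine exists_dense_orbit H.cont H.isCompact_staying.isClosed H.nonempty_staying hmaps ?_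
    intro x hx y hy ε hε
    obtain ⟨n, hn⟩ := H.exists_near hε
    -- Concatenation: n symbols of x followed by the itinerary of y give a point near x that lands
    -- exactly on y.
    obtain ⟨z, hz, hzs⟩ := H.exists_itinerary
      fun i => if i < n then itinerary f v x i else itinerary f v y (i - n)
    refine ⟨z, hz, ?_, n, ?_⟩
    · exact hn z hz x hx fun i hi => by rw [hzs, if_pos hi]
    · have : f^[n] z = y := by
        refine H.eq_of_itinerary_eq (iterate_mem_staying hz _) hy (funext fun i => ?_)
        rw [itinerary_iterate, hzs, if_neg (by omega), Nat.add_sub_cancel]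
      rw [this, sub_self, abs_zero]
      exact hε

end Horseshoe

theorem ConjugateToShift.congr {f g : ℝ → ℝ} {A : Set ℝ} (hg : ConjugateToShift g A)
    (h : EqOn f g A) : ConjugateToShift f A := by
  obtain ⟨hm, φ, hφ⟩ := hg
  have hm' : MapsTo f A A := fun x hx => by rw [h hx]; exact hm hx
  refine ⟨hm', φ, fun x => ?_⟩
  rw [← hφ x]
  congr 1
  exact Subtype.ext (h x.2)


/-! ### The tent map to the right of its left fixed point -/

/-- The number `e` is the fixed point of the tent map to the left of the turning point. -/
structure LeftFixed (a b r h e : ℝ) : Prop where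
  one_lt : 1 < a
  b_pos : 0 < b
  h_pos : 0 < h
  eq : (a - 1) * (r - e) = h

namespace LeftFixed
variable {a b r h e : ℝ} (E : LeftFixed a b r h e)
include E

theorem left {x : ℝ} (hx : x ≤ r) : tent a b r h x = r + h - a * (r - x) :=
  tent_left (by linarith [E.one_lt]) E.b_pos.le hx

theorem right {x : ℝ} (hx : r ≤ x) : tent a b r h x = r + h - b * (x - r) :=
  tent_right (by linarith [E.one_lt]) E.b_pos.le hx

theorem le_top (x : ℝ) : tent a b r h x ≤ r + h :=
  tent_le (by linarith [E.one_lt]) E.b_pos.le x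

theorem lt_turn : e < r := by
  by_contra hcon
  have := E.one_lt
  have := E.h_pos
  have := E.eq
  nlinarith

theorem affine {x : ℝ} (hx : x ≤ r) : tent a b r h x - e = a * (x - e) := by
  rw [E.left hx]
  linarith [E.eq]

theorem surjOn_left {y : ℝ} (hy : y ∈ Icc e (r + h)) : ∃ x ∈ Icc e r, tent a b r h x = y := by
  have ha := E.one_lt
  have h1 : 0 ≤ (y - e) / a := div_nonneg (by linarith [hy.1]) (by linarith)
  have h2 : (y - e) / a ≤ r - e := by
    rw [div_le_iff₀ (by linarith)]
    linarith [hy.2, E.eq]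
  refine ⟨e + (y - e) / a, ⟨by linarith, by linarith⟩, ?_⟩
  have h3 := E.affine (x := e + (y - e) / a) (by linarith)
  have h4 : a * (e + (y - e) / a - e) = y - e := by field_simp; ring
  linarith

theorem image_eq (hm : MapsTo (tent a b r h) (Icc e (r + h)) (Icc e (r + h))) :
    tent a b r h '' Icc e (r + h) = Icc e (r + h) := by
  refine (mapsTo_iff_image_subset.1 hm).antisymm fun y hy => ?_
  obtain ⟨x, hx, hxy⟩ := E.surjOn_left hy
  exact ⟨x, ⟨hx.1, hx.2.trans (by linarith [E.h_pos])⟩, hxy⟩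

/-- Below w ≤ r the distance to e is multiplied by a > 1 at each step. -/
theorem exists_iterate_ge (hm : MapsTo (tent a b r h) (Icc e (r + h)) (Icc e (r + h))) {w y : ℝ}
    (hw : w ≤ r) (hy : y ∈ Icc e (r + h)) (hye : y ≠ e) :
    ∃ n : ℕ, (tent a b r h)^[n] y ∈ Icc w (r + h) := by
  have ha := E.one_lt
  obtain ⟨n, hn⟩ := exists_iterate_notMem (S := Ico e w) (f := tent a b r h) (β := a) (ρ := r - e)
    (by rwa [abs_of_pos (by linarith)])
    (fun x hx => by rw [abs_of_nonneg (by linarith [hx.1])]; linarith [hx.2])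
    (fun x hx => E.affine (hx.2.le.trans hw)) hye
  have h1 := hm.iterate n hy
  exact ⟨n, le_of_not_gt fun h2 => hn ⟨h1.1, h2⟩, h1.2⟩

theorem mapsTo_of_lt_one (hb : b < 1) :
    MapsTo (tent a b r h) (Icc e (r + h)) (Icc e (r + h)) := by
  intro x hx
  refine ⟨?_, E.le_top x⟩
  have h1 := E.lt_turn
  rcases le_total x r with h2 | h2
  · have h3 := E.affine h2
    have := mul_nonneg (by linarith [E.one_lt] : 0 ≤ a) (sub_nonneg.2 hx.1)
    linarith
  · rw [E.right h2]
    nlinarith [hx.2]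

/-- If the right branch is contracting, then all trajectories converge to its fixed point. -/
theorem tendsto_of_lt_one (hb : b < 1) {z : ℝ} (hz : r < z) (hfix : tent a b r h z = z) {x : ℝ}
    (hx : x ∈ Icc e (r + h)) (hxe : x ≠ e) :
    Tendsto (fun n : ℕ => (tent a b r h)^[n] x) atTop (𝓝 z) := by
  obtain ⟨n, hn⟩ := E.exists_iterate_ge (E.mapsTo_of_lt_one hb) le_rfl hx hxe
  set f := tent a b r h with hf
  have hb0 := E.b_pos
  have hmaps : MapsTo f (Icc r (r + h)) (Icc r (r + h)) := by
    intro y hy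
    refine ⟨?_, E.le_top y⟩
    rw [hf, E.right hy.1]
    nlinarith [hy.1, hy.2]
  have hcontr : ∀ k : ℕ, |f^[k] (f^[n] x) - z| = b ^ k * |f^[n] x - z| := by
    intro k
    induction k with
    | zero => simp
    | succ k ih =>
      have h1 := (hmaps.iterate k hn).1
      have h2 : f (f^[k] (f^[n] x)) - z = -(b * (f^[k] (f^[n] x) - z)) := by
        rw [hf, E.right hz.le] at hfix
        rw [show f (f^[k] (f^[n] x)) = _ from E.right h1]
        linarith
      rw [Function.iterate_succ_apply', h2, abs_neg, abs_mul, ih, abs_of_pos hb0]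
      ring
  rw [← tendsto_add_atTop_iff_nat n, tendsto_iff_norm_sub_tendsto_zero]
  have h0 : Tendsto (fun k : ℕ => b ^ k * |f^[n] x - z|) atTop (𝓝 0) := by
    simpa using (tendsto_pow_atTop_nhds_zero_of_lt_one hb0.le hb).mul_const |f^[n] x - z|
  refine h0.congr fun k => ?_
  rw [← hcontr, Real.norm_eq_abs, Function.iterate_add_apply]

/-- Multiplied by a - 1, the inequality (b - 1)h < r - e becomes (a - 1)(b - 1) < 1, which is ab < a
+ b. -/
theorem lt_low (P : TentParam a b h) : e < r + h - b * h := by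
  have h1 := E.eq
  have h2 := P.one_lt_a
  have h3 := P.one_lt_b
  have h4 := P.mul_lt
  have h5 : (a - 1) * ((b - 1) * h) < (a - 1) * (r - e) := by
    rw [h1]
    nlinarith [P.h_pos]
  have := lt_of_mul_lt_mul_left h5 (by linarith)
  linarith

theorem mapsTo_of_tentParam (P : TentParam a b h) :
    MapsTo (tent a b r h) (Icc e (r + h)) (Icc e (r + h)) := by
  intro x hx
  have h1 := E.lt_low P
  rcases le_total x (r + h - b * h) with h2 | h2
  · refine ⟨?_, E.le_top x⟩
    have h3 := E.affine (h2.trans P.low_lt.le)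
    have := mul_nonneg P.a_nonneg (sub_nonneg.2 hx.1)
    linarith
  · have h3 := P.mapsTo (r := r) ⟨h2, hx.2⟩
    exact ⟨h1.le.trans h3.1, h3.2⟩

/-- The right end of the set of the points which are not mapped below the fixed point. -/
theorem cut_lt_top (hab : a + b < a * b) : r + (r + h - e) / b < r + h := by
  have h1 := E.eq
  have h2 := E.lt_turn
  have h3 := E.b_pos
  have : (r + h - e) / b < h := by
    rw [div_lt_iff₀ h3]
    nlinarith
  linarith

/-- The point c is the preimage of e on the right branch. The ends u and v of the gap are the two
preimages of c, and the points between them are mapped above c. -/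
theorem horseshoe (hb : 1 < b) (hab : a + b < a * b) {c : ℝ} (hc : c = r + (r + h - e) / b) :
    Horseshoe (tent a b r h) (min a b) e (r - (r + h - c) / a) (r + (r + h - c) / b) c := by
  have ha := E.one_lt
  have ha0 : 0 < a := by linarith
  have hb0 := E.b_pos
  have her := E.lt_turn
  have hh := E.h_pos
  have heq : r + h - e = a * (r - e) := by linarith [E.eq]
  have hct : c < r + h := hc ▸ E.cut_lt_top hab
  have hcr : r < c := by
    have : 0 < (r + h - e) / b := div_pos (by linarith) hb0
    linarith
  have hcb : b * (c - r) = r + h - e := by rw [hc]; field_simp; ring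
  have hua : 0 < (r + h - c) / a := div_pos (by linarith) ha0
  have hvb : 0 < (r + h - c) / b := div_pos (by linarith) hb0
  have hua' : a * ((r + h - c) / a) = r + h - c := by field_simp
  have hvb' : b * ((r + h - c) / b) = r + h - c := by field_simp
  have heu : e ≤ r - (r + h - c) / a := by
    have : (r + h - c) / a ≤ r - e := by rw [div_le_iff₀ ha0]; linarith
    linarith
  have hvc : r + (r + h - c) / b ≤ c := by
    have : (r + h - c) / b ≤ c - r := by rw [div_le_iff₀ hb0]; linarith
    linarith
  refine ⟨continuous_tent, lt_min ha hb, by linarith, heu, hvc, ?_, ?_, ?_, ?_, ?_⟩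
  · intro y hy
    obtain ⟨x, hx, hxy⟩ := E.surjOn_left ⟨hy.1, hy.2.trans hct.le⟩
    refine ⟨x, ⟨hx.1, ?_⟩, hxy⟩
    rw [E.left hx.2] at hxy
    have : a * ((r + h - c) / a) ≤ a * (r - x) := by rw [hua']; linarith [hy.2]
    linarith [le_of_mul_le_mul_left this ha0]
  · intro y hy
    have h1 : (r + h - y) / b * b = r + h - y := by field_simp
    have h2 : (r + h - c) / b ≤ (r + h - y) / b := by
      have := hy.2
      gcongr
    have h3 : (r + h - y) / b ≤ c - r := by
      rw [div_le_iff₀ hb0]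
      linarith [hy.1]
    refine ⟨r + (r + h - y) / b, ⟨by linarith, by linarith⟩, ?_⟩
    rw [E.right (by linarith)]
    linarith
  · intro x hx y hy
    rw [E.left (by linarith [hx.2]), E.left (by linarith [hy.2]),
      show r + h - a * (r - x) - (r + h - a * (r - y)) = a * (x - y) by ring, abs_mul,
      abs_of_pos ha0]
    exact mul_le_mul_of_nonneg_right (min_le_left _ _) (abs_nonneg _)
  · intro x hx y hy
    rw [E.right (by linarith [hx.1]), E.right (by linarith [hy.1]),
      show r + h - b * (x - r) - (r + h - b * (y - r)) = -(b * (x - y)) by ring, abs_neg, abs_mul,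
      abs_of_pos hb0]
    exact mul_le_mul_of_nonneg_right (min_le_right _ _) (abs_nonneg _)
  · intro x hx hfx
    rcases le_total x r with h1 | h1
    · left
      rw [E.left h1] at hfx
      have : a * ((r + h - c) / a) ≤ a * (r - x) := by rw [hua']; linarith [hfx.2]
      exact ⟨hx.1, by linarith [le_of_mul_le_mul_left this ha0]⟩
    · right
      rw [E.right h1] at hfx
      have : b * ((r + h - c) / b) ≤ b * (x - r) := by rw [hvb']; linarith [hfx.2]
      exact ⟨by linarith [le_of_mul_le_mul_left this hb0], hx.2⟩

end LeftFixed

/-! ### The saw map -/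

section
variable {p q r : ℕ → ℝ} {T : ℝ → ℝ}

theorem saw_left (hs : IsSawSeq p q r) (hT : IsSawMap p q r T) {k : ℕ} {x : ℝ}
    (hx : x ∈ Icc (q (k + 1)) (r k)) : T x = alpha p q r k * (x - q (k + 1)) := by
  obtain ⟨m, c, h⟩ := hT.linear_left k
  have hlt := hs.q_lt_r k
  have h1 := h _ (left_mem_Icc.2 hlt.le)
  have h2 := h _ (right_mem_Icc.2 hlt.le)
  rw [hT.map_q _ (by omega)] at h1
  rw [hT.map_r] at h2
  have h3 : alpha p q r k = m := by
    rw [alpha, div_eq_iff (by linarith)]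
    linarith
  rw [h x hx, h3]
  linarith

theorem saw_right (hs : IsSawSeq p q r) (hT : IsSawMap p q r T) {k : ℕ} (hk : 1 ≤ k) {x : ℝ}
    (hx : x ∈ Icc (r k) (q k)) : T x = beta p q r k * (q k - x) := by
  obtain ⟨m, c, h⟩ := hT.linear_right k hk
  have hlt := hs.r_lt_q k hk
  have h1 := h _ (left_mem_Icc.2 hlt.le)
  have h2 := h _ (right_mem_Icc.2 hlt.le)
  rw [hT.map_q _ hk] at h2
  rw [hT.map_r] at h1
  have h3 : beta p q r k = -m := by
    rw [beta, div_eq_iff (by linarith)]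
    linarith
  rw [h x hx, h3]
  linarith

theorem alpha_mul (hs : IsSawSeq p q r) (k : ℕ) : alpha p q r k * (r k - q (k + 1)) = p k := by
  have := hs.q_lt_r k
  rw [alpha, div_mul_cancel₀ _ (by linarith)]

theorem beta_mul (hs : IsSawSeq p q r) {k : ℕ} (hk : 1 ≤ k) :
    beta p q r k * (q k - r k) = p k := by
  have := hs.r_lt_q k hk
  rw [beta, div_mul_cancel₀ _ (by linarith)]

theorem alpha_pos (hs : IsSawSeq p q r) (k : ℕ) : 0 < alpha p q r k :=
  div_pos (hs.p_pos k) (by linarith [hs.q_lt_r k])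

theorem beta_pos (hs : IsSawSeq p q r) {k : ℕ} (hk : 1 ≤ k) : 0 < beta p q r k :=
  div_pos (hs.p_pos k) (by linarith [hs.r_lt_q k hk])

theorem one_lt_alpha (hs : IsSawSeq p q r) {k : ℕ} (hk : 1 ≤ k) : 1 < alpha p q r k := by
  have h1 := hs.q_lt_r k
  rw [alpha, one_lt_div (by linarith)]
  linarith [hs.r_lt_p k hk, hs.q_pos (k + 1) (by omega)]

/-- On `[q (k + 1), q k]` the saw map is a skew tent map. -/
theorem saw_eqOn_tent (hs : IsSawSeq p q r) (hT : IsSawMap p q r T) {k : ℕ} (hk : 1 ≤ k) :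
    EqOn T (tent (alpha p q r k) (beta p q r k) (r k) (p k - r k)) (Icc (q (k + 1)) (q k)) := by
  intro x hx
  have ha := (alpha_pos hs k).le
  have hb := (beta_pos hs hk).le
  rcases le_total x (r k) with h | h
  · rw [saw_left hs hT ⟨hx.1, h⟩, tent_left ha hb h]
    linarith [alpha_mul hs k]
  · rw [saw_right hs hT hk ⟨h, hx.2⟩, tent_right ha hb h]
    linarith [beta_mul hs hk]

theorem leftFixed_e (hs : IsSawSeq p q r) (hT : IsSawMap p q r T) {k : ℕ} (hk : 1 ≤ k) :
    LeftFixed (alpha p q r k) (beta p q r k) (r k) (p k - r k) (e T q r k) := by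
  refine ⟨one_lt_alpha hs hk, beta_pos hs hk, by linarith [hs.r_lt_p k hk], ?_⟩
  obtain ⟨he, hfix⟩ := e_spec hs hT hk
  rw [saw_left hs hT (Ioo_subset_Icc_self he)] at hfix
  linarith [alpha_mul hs k]

theorem p_antitone (hs : IsSawSeq p q r) : Antitone p :=
  antitone_nat_of_succ_le fun k => (hs.p_anti k).le

theorem saw_mem_Icc (hs : IsSawSeq p q r) (hT : IsSawMap p q r T) {k : ℕ} (hk : 1 ≤ k) {x : ℝ}
    (hx : x ∈ Icc (q (k + 1)) (q k)) : T x ∈ Icc 0 (p k) := by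
  constructor
  · rcases le_total x (r k) with h | h
    · rw [saw_left hs hT ⟨hx.1, h⟩]
      exact mul_nonneg (alpha_pos hs k).le (by linarith [hx.1])
    · rw [saw_right hs hT hk ⟨h, hx.2⟩]
      exact mul_nonneg (beta_pos hs hk).le (by linarith [hx.2])
  · rw [saw_eqOn_tent hs hT hk hx]
    exact (tent_le (alpha_pos hs k).le (beta_pos hs hk).le x).trans (by linarith)

theorem exists_mem_segment (hs : IsSawSeq p q r) {k : ℕ} {x : ℝ} (hx : 0 < x)
    (hxk : x < q (k + 1)) : ∃ j, k + 1 ≤ j ∧ x ∈ Icc (q (j + 1)) (q j) := by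
  have hex : ∃ m, q (k + 1 + m) < x := by
    obtain ⟨n, hn⟩ := ((hs.q_tendsto.eventually_lt_const hx).and (eventually_ge_atTop (k + 1))).exists
    exact ⟨n - (k + 1), by rw [Nat.add_sub_cancel' hn.2]; exact hn.1⟩
  classical
  obtain ⟨m, hm, hmin⟩ : ∃ m, q (k + 1 + m) < x ∧ ∀ i < m, ¬ q (k + 1 + i) < x :=
    ⟨Nat.find hex, Nat.find_spec hex, fun i hi => Nat.find_min hex hi⟩
  rcases m with _ | m
  · exact absurd hm (not_lt.2 hxk.le)
  · exact ⟨k + 1 + m, by omega, hm.le, not_lt.1 (hmin m (by omega))⟩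

/-- If the next peak is lower than `e k`, then no trajectory starting below `e k` reaches it. -/
theorem mapsTo_below_e (hs : IsSawSeq p q r) (hT : IsSawMap p q r T) {k : ℕ} (hk : 1 ≤ k)
    (hp : p (k + 1) < e T q r k) : MapsTo T (Ico 0 (e T q r k)) (Ico 0 (e T q r k)) := by
  intro x hx
  obtain ⟨he, hfix⟩ := e_spec hs hT hk
  rcases le_or_gt (q (k + 1)) x with h | h
  · have h1 := saw_left hs hT ⟨h, hx.2.le.trans he.2.le⟩
    have h2 := saw_left hs hT (Ioo_subset_Icc_self he)
    rw [hfix] at h2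
    have h3 := alpha_pos hs k
    constructor
    · rw [h1]; exact mul_nonneg h3.le (by linarith)
    · rw [h1, h2]; exact mul_lt_mul_of_pos_left (by linarith [hx.2]) h3
  · rcases hx.1.eq_or_lt with h0 | h0
    · rw [← h0, hT.map_zero]
      exact ⟨le_rfl, h0 ▸ hx.2⟩
    · obtain ⟨j, hj, hxj⟩ := exists_mem_segment hs h0 h
      have h1 := saw_mem_Icc hs hT (by omega) hxj
      exact ⟨h1.1, (h1.2.trans (p_antitone hs hj)).trans_lt hp⟩

end

/-! ### The three cases for the saw map -/

section
variable {p q r : ℕ → ℝ} {T : ℝ → ℝ}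

/-- The sum of the inverse slopes is (q_k - q_(k+1))/p_k, so the hypothesis says that the tooth is
lower than its base is wide; hence J_k does not reach past q_k and only one tent is involved. -/
theorem p_lt_q_of_inv (hs : IsSawSeq p q r) {k : ℕ} (hk : 1 ≤ k)
    (h : 1 < (alpha p q r k)⁻¹ + (beta p q r k)⁻¹) : p k < q k := by
  have h1 := hs.p_pos k
  rw [alpha, beta, inv_div, inv_div, ← add_div, one_lt_div h1] at h
  linarith [hs.q_pos (k + 1) (by omega)]

theorem p_lt_q_of_beta (hs : IsSawSeq p q r) {k : ℕ} (hk : 1 ≤ k) (h : beta p q r k < 1) :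
    p k < q k := by
  rw [beta, div_lt_one (by linarith [hs.r_lt_q k hk])] at h
  linarith [hs.r_pos k]

theorem mul_lt_add_iff_inv {a b : ℝ} (ha : 0 < a) (hb : 0 < b) :
    (a * b < a + b ↔ 1 < a⁻¹ + b⁻¹) ∧ (a + b < a * b ↔ a⁻¹ + b⁻¹ < 1) := by
  have h : a⁻¹ + b⁻¹ = (a + b) / (a * b) := by field_simp; ring
  rw [h, one_lt_div (mul_pos ha hb), div_lt_one (mul_pos ha hb)]
  exact ⟨Iff.rfl, Iff.rfl⟩

theorem J_subset (hs : IsSawSeq p q r) (hT : IsSawMap p q r T) {k : ℕ} (hk : 1 ≤ k)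
    (hpq : p k ≤ q k) : J p q r T k ⊆ Icc (q (k + 1)) (q k) :=
  Icc_subset_Icc (e_spec hs hT hk).1.1.le hpq

theorem eHat_isStable (hs : IsSawSeq p q r) (hT : IsSawMap p q r T) {k : ℕ} (hk : 1 ≤ k)
    (hb : beta p q r k < 1) (X : Set ℝ) : IsStable X T {eHat T q r k} := by
  obtain ⟨hz, hfix⟩ := eHat_spec hs hT hk
  set z := eHat T q r k
  intro ε hε
  -- This radius keeps the points on the right branch, where the distance to z shrinks by the factor
  -- β_k.
  refine ⟨min ε (min (z - r k) (q k - z)),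
    lt_min hε (lt_min (by linarith [hz.1]) (by linarith [hz.2])), fun x _ hx n => ?_⟩
  simp only [Metric.infDist_singleton, Real.dist_eq] at hx ⊢
  rw [lt_min_iff, lt_min_iff] at hx
  have key : |T^[n] x - z| ≤ |x - z| := by
    induction n with
    | zero => exact le_rfl
    | succ n ih =>
      have h1 := abs_le.1 (ih.trans hx.2.1.le)
      have h2 := abs_le.1 (ih.trans hx.2.2.le)
      have h3 : T (T^[n] x) - z = -(beta p q r k * (T^[n] x - z)) := by
        have h4 := saw_right hs hT hk (Ioo_subset_Icc_self hz)
        rw [hfix] at h4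
        rw [saw_right hs hT hk ⟨by linarith [h1.1], by linarith [h2.2]⟩]
        linarith
      rw [Function.iterate_succ_apply', h3, abs_neg, abs_mul, abs_of_pos (beta_pos hs hk)]
      exact (mul_le_of_le_one_left (abs_nonneg _) hb.le).trans ih
  exact key.trans_lt hx.1

theorem attracting_case (hs : IsSawSeq p q r) (hT : IsSawMap p q r T) {k : ℕ} (hk : 1 ≤ k)
    (hb : beta p q r k < 1) :
    IsInvariant T (J p q r T k) ∧ eHat T q r k ∈ J p q r T k ∧
      IsStable (Icc 0 (r 0)) T {eHat T q r k} ∧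
      ∀ x ∈ J p q r T k \ {e T q r k},
        Tendsto (fun n : ℕ => T^[n] x) atTop (𝓝 (eHat T q r k)) := by
  have hpq := p_lt_q_of_beta hs hk hb
  have E := leftFixed_e hs hT hk
  have heq := (saw_eqOn_tent hs hT hk).mono (J_subset hs hT hk hpq.le)
  have hJ : J p q r T k = Icc (e T q r k) (r k + (p k - r k)) := by rw [add_sub_cancel]; rfl
  obtain ⟨hz, hfix⟩ := eHat_spec hs hT hk
  have he := (e_spec hs hT hk).1
  have hzp : eHat T q r k ≤ p k := by
    have h1 := saw_right hs hT hk (Ioo_subset_Icc_self hz)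
    rw [hfix] at h1
    nlinarith [beta_mul hs hk, beta_pos hs hk, hz.1]
  have hzJ : eHat T q r k ∈ J p q r T k := ⟨(he.2.trans hz.1).le, hzp⟩
  have hm := E.mapsTo_of_lt_one hb
  refine ⟨?_, hzJ, eHat_isStable hs hT hk hb _, ?_⟩
  · rw [IsInvariant, image_congr heq, hJ, E.image_eq hm]
  · intro x hx
    rw [← hJ] at hm
    have h1 : (fun n : ℕ => T^[n] x) = fun n : ℕ => (tent (alpha p q r k) (beta p q r k) (r k) (p k - r k))^[n] x :=
      funext fun n => iterate_eq_of_eqOn heq hm n hx.1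
    rw [h1]
    exact E.tendsto_of_lt_one hb hz.1 (by rw [← heq hzJ, hfix]) (hJ ▸ hx.1) hx.2

theorem interval_cycle_case (hs : IsSawSeq p q r) (hT : IsSawMap p q r T) {k : ℕ} (hk : 1 ≤ k)
    (hb : 1 < beta p q r k) (hab : 1 < (alpha p q r k)⁻¹ + (beta p q r k)⁻¹) :
    IsInvariant T (J p q r T k) ∧ G p T k ⊂ J p q r T k ∧ IsInvariant T (G p T k) ∧
      (∃ N A B x Λ, IntervalCycle T (T (p k)) (p k) N A B x Λ) ∧
      (∀ y ∈ J p q r T k \ (G p T k ∪ {e T q r k}),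
        ∃ n₁ : ℕ, ∀ n ≥ n₁, T^[n] y ∈ G p T k) := by
  have hpq := p_lt_q_of_inv hs hk hab
  have E := leftFixed_e hs hT hk
  have heq := (saw_eqOn_tent hs hT hk).mono (J_subset hs hT hk hpq.le)
  have hrp := hs.r_lt_p k hk
  have P : TentParam (alpha p q r k) (beta p q r k) (p k - r k) :=
    ⟨one_lt_alpha hs hk, hb, by linarith,
      (mul_lt_add_iff_inv (alpha_pos hs k) (beta_pos hs hk)).1.2 hab⟩
  have htop : r k + (p k - r k) = p k := by ring
  have hlow : r k + (p k - r k) - beta p q r k * (p k - r k) = T (p k) := by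
    rw [saw_right hs hT hk ⟨hrp.le, hpq.le⟩, htop]
    linarith [beta_mul hs hk]
  have hlt := E.lt_low P
  have hlr := P.low_lt (r := r k)
  have hmJ := E.mapsTo_of_tentParam P
  have himJ := E.image_eq hmJ
  have hmG := P.mapsTo (r := r k)
  have himG := P.image_core (r := r k)
  obtain ⟨N, A, B, x, Λ, hc⟩ := P.exists_intervalCycle (r := r k)
  rw [hlow, htop] at hmG himG hc
  rw [hlow] at hlt hlr
  rw [htop] at himJ
  have hmJ' : MapsTo (tent (alpha p q r k) (beta p q r k) (r k) (p k - r k))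
      (J p q r T k) (J p q r T k) := by
    rw [htop] at hmJ
    exact hmJ
  have hGJ : G p T k ⊆ J p q r T k := Icc_subset_Icc_left hlt.le
  have hGinv : IsInvariant T (G p T k) := (image_congr (heq.mono hGJ)).trans himG
  refine ⟨(image_congr heq).trans himJ, ?_, hGinv,
    ⟨N, A, B, x, Λ, hc.congr (heq.mono hGJ) hmG⟩, ?_⟩
  · refine ssubset_of_subset_of_ne hGJ fun h => ?_
    have h1 : e T q r k ∈ G p T k := by
      rw [h]
      exact left_mem_Icc.2 (by linarith)
    exact absurd h1.1 (not_le.2 hlt)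
  · intro y hy
    have hmT : MapsTo T (G p T k) (G p T k) := mapsTo_iff_image_subset.2 hGinv.subset
    obtain ⟨n, hn⟩ := E.exists_iterate_ge hmJ (w := T (p k)) hlr.le (by rw [htop]; exact hy.1)
      fun h => hy.2 (Or.inr h)
    rw [htop, ← iterate_eq_of_eqOn heq hmJ' n hy.1] at hn
    refine ⟨n, fun m hm => ?_⟩
    obtain ⟨d, rfl⟩ := Nat.exists_eq_add_of_le' hm
    rw [Function.iterate_add_apply]
    exact hmT.iterate d hn

theorem cantor_case {kstar : ℕ} (hs : IsSawSeq p q r) (hT : IsSawMap p q r T)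
    (hstd : StandingAssumptions p q r T kstar) {k : ℕ} (hk : 1 ≤ k)
    (hab : (alpha p q r k)⁻¹ + (beta p q r k)⁻¹ < 1) (hk' : k + 1 ≤ kstar) :
    ∃ Λ : Set ℝ, Λ ⊆ J p q r T k ∧ IsCantorSet Λ ∧ IsChaotic T Λ ∧ ConjugateToShift T Λ ∧
      ∀ x ∈ J p q r T k \ Λ, ∃ n₂ : ℕ, ∀ n ≥ n₂, T^[n] x ∈ Ico 0 (e T q r k) := by
  have E := leftFixed_e hs hT hk
  have ha0 := alpha_pos hs k
  have hb0 := beta_pos hs hk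
  have hb : 1 < beta p q r k := by
    by_contra hcon
    have h1 := (one_le_inv₀ hb0).2 (not_lt.1 hcon)
    have h2 := inv_pos.2 ha0
    linarith
  have hsum := (mul_lt_add_iff_inv ha0 hb0).2.2 hab
  have hrp := hs.r_lt_p k hk
  have he := (e_spec hs hT hk).1
  have he0 : 0 < e T q r k := (hs.q_pos (k + 1) (by omega)).trans he.1
  have hcp := E.cut_lt_top hsum
  set c := r k + (r k + (p k - r k) - e T q r k) / beta p q r k with hc
  have H := E.horseshoe hb hsum hc
  set f := tent (alpha p q r k) (beta p q r k) (r k) (p k - r k) with hf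
  rw [add_sub_cancel] at hcp
  have hcb : beta p q r k * (c - r k) = p k - e T q r k := by
    rw [hc]
    field_simp
    ring
  have hqc : beta p q r k * (q k - c) = e T q r k := by linarith [beta_mul hs hk]
  have hcq : c < q k := by
    have := pos_of_mul_pos_right (hqc ▸ he0) hb0.le
    linarith
  have heq : EqOn T f (Icc (e T q r k) c) :=
    (saw_eqOn_tent hs hT hk).mono (Icc_subset_Icc he.1.le hcq.le)
  have hstay : staying f (e T q r k) c ⊆ Icc (e T q r k) c := fun x hx => hx 0
  have hbelow := mapsTo_below_e hs hT hk (hstd.p_lt (k + 1) (by omega) hk')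
  -- the points to the right of `c` are mapped below `e k`
  have hright : ∀ x ∈ Ioc c (p k), T x ∈ Ico 0 (e T q r k) := by
    intro x hx
    have hrc : r k < c := by
      have : 0 < beta p q r k * (c - r k) := by linarith [he.2]
      linarith [pos_of_mul_pos_right this hb0.le]
    rcases le_total x (q k) with h | h
    · rw [saw_right hs hT hk ⟨(hrc.trans hx.1).le, h⟩]
      refine ⟨mul_nonneg hb0.le (by linarith), ?_⟩
      calc beta p q r k * (q k - x) < beta p q r k * (q k - c) :=
            mul_lt_mul_of_pos_left (by linarith [hx.1]) hb0
        _ = e T q r k := hqc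
    -- Here p_k may exceed q_k, and x lies on the rising side of tooth j = k - 1. That p_k does not
    -- pass the peak r_j follows from p_k < e_j for j ≥ 1 and from p_1 < p_0 < r_0 for j = 0; the
    -- technical assumption then bounds the image by e_k.
    · obtain ⟨j, rfl⟩ := Nat.exists_eq_add_of_le' hk
      have hpr : p (j + 1) ≤ r j := by
        rcases Nat.eq_zero_or_pos j with rfl | hj
        · linarith [hs.p_anti 0, hs.p_zero_lt]
        · exact (hstd.p_lt (j + 1) (by omega) (by omega)).le.trans (e_spec hs hT hj).1.2.le
      have ht := hstd.technical (j + 1) hk hk'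
      rw [Nat.add_sub_cancel] at ht
      have haj := alpha_pos hs j
      rw [saw_left hs hT ⟨h, hx.2.trans hpr⟩]
      refine ⟨mul_nonneg haj.le (by linarith), ?_⟩
      have h1 : x - q (j + 1) < e T q r (j + 1) / alpha p q r j := by linarith [hx.2]
      rw [lt_div_iff₀ haj] at h1
      linarith
  refine ⟨staying f (e T q r k) c, hstay.trans (Icc_subset_Icc_right hcp.le), H.isCantorSet,
    H.isChaotic.congr (heq.mono hstay), H.conjugateToShift.congr (heq.mono hstay), ?_⟩
  intro x hx
  suffices h : ∃ n, T^[n] x ∈ Ico 0 (e T q r k) by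
    obtain ⟨n, hn⟩ := h
    refine ⟨n, fun m hm => ?_⟩
    obtain ⟨d, rfl⟩ := Nat.exists_eq_add_of_le' hm
    rw [Function.iterate_add_apply]
    exact hbelow.iterate d hn
  by_contra! hcon
  -- A trajectory that never falls below e_k stays in [e_k, c], where T and the tent map agree; its
  -- starting point then belongs to the Cantor set.
  have hnext : ∀ y ∈ J p q r T k, T y ∉ Ico 0 (e T q r k) →
      y ∈ Icc (e T q r k) c ∧ T y ∈ J p q r T k := by
    intro y hy hTy
    have hyc : y ≤ c := le_of_not_gt fun h => hTy (hright y ⟨h, hy.2⟩)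
    have h1 := saw_mem_Icc hs hT hk (x := y) ⟨he.1.le.trans hy.1, hyc.trans hcq.le⟩
    exact ⟨⟨hy.1, hyc⟩, le_of_not_gt fun h => hTy ⟨h1.1, h⟩, h1.2⟩
  have hJ : ∀ n, T^[n] x ∈ J p q r T k := by
    intro n
    induction n with
    | zero => exact hx.1
    | succ n ih =>
      rw [Function.iterate_succ_apply']
      refine (hnext _ ih ?_).2
      rw [← Function.iterate_succ_apply' T]
      exact hcon (n + 1)
  have hIcc : ∀ n, T^[n] x ∈ Icc (e T q r k) c := by
    intro n
    refine (hnext _ (hJ n) ?_).1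
    rw [← Function.iterate_succ_apply' T]
    exact hcon (n + 1)
  have hit : ∀ n, f^[n] x = T^[n] x := by
    intro n
    induction n with
    | zero => rfl
    | succ n ih =>
      rw [Function.iterate_succ_apply', Function.iterate_succ_apply', ih, heq (hIcc n)]
  exact hx.2 fun n => by rw [hit]; exact hIcc n

theorem core_subset (hs : IsSawSeq p q r) (hT : IsSawMap p q r T) {k : ℕ} (hk : 1 ≤ k)
    (hGJ : G p T k ⊆ J p q r T k) : Icc (T (p k)) (p k) ⊆ Icc 0 (r 0) := by
  intro x hx
  have h1 := (e_spec hs hT hk).1.1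
  have h2 := hs.q_pos (k + 1) (by omega)
  exact ⟨(h2.trans h1).le.trans (hGJ hx).1,
    hx.2.trans ((p_antitone hs (Nat.zero_le k)).trans hs.p_zero_lt.le)⟩

end
end Saw

theorem theorem2 (p q r : ℕ → ℝ) (T : ℝ → ℝ) (kstar : ℕ)
    (hseq : Saw.IsSawSeq p q r) (hT : Saw.IsSawMap p q r T)
    (hstd : Saw.StandingAssumptions p q r T kstar)
    (k : ℕ) (hk : 1 ≤ k) (hkstar : k ≤ kstar) :
    -- first case
    (Saw.beta p q r k < 1 →
      Saw.IsInvariant T (Saw.J p q r T k) ∧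
      Saw.eHat T q r k ∈ Saw.J p q r T k ∧
      Saw.IsStable (Icc 0 (r 0)) T {Saw.eHat T q r k} ∧
      ∀ x ∈ Saw.J p q r T k \ {Saw.e T q r k},
        Tendsto (fun n : ℕ => T^[n] x) atTop (𝓝 (Saw.eHat T q r k))) ∧
    -- second case
    (1 < Saw.beta p q r k → 1 < (Saw.alpha p q r k)⁻¹ + (Saw.beta p q r k)⁻¹ →
      Saw.IsInvariant T (Saw.J p q r T k) ∧
      Saw.G p T k ⊂ Saw.J p q r T k ∧
      Saw.IsInvariant T (Saw.G p T k) ∧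
      (∃ (N : ℕ) (a b : ℕ → ℝ) (x : ℕ → ℝ) (Λ : Set ℝ),
        -- the closed intervals `[a i, b i]`, `1 ≤ i ≤ 2 ^ N`, and their union
        (∀ i ∈ Icc 1 (2 ^ N), a i < b i) ∧
        (∀ i ∈ Icc 1 (2 ^ N), ∀ j ∈ Icc 1 (2 ^ N), i ≠ j →
          Disjoint (Icc (a i) (b i)) (Icc (a j) (b j))) ∧
        Λ = ⋃ i ∈ Icc 1 (2 ^ N), Icc (a i) (b i) ∧
        Λ ⊆ Saw.G p T k ∧
        Saw.IsChaotic T Λ ∧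
        -- the cyclic permutation of the intervals and their order on the line
        (∀ i, 1 ≤ i → i + 1 ≤ 2 ^ N → T '' Icc (a i) (b i) = Icc (a (i + 1)) (b (i + 1))) ∧
        T '' Icc (a (2 ^ N)) (b (2 ^ N)) = Icc (a 1) (b 1) ∧
        BijOn (Saw.sigma N) (Icc 1 (2 ^ N)) (Icc 1 (2 ^ N)) ∧
        (∀ i, 1 ≤ i → i + 1 ≤ 2 ^ N → b (Saw.sigma N i) < a (Saw.sigma N (i + 1))) ∧
        -- the unstable periodic orbits
        (∀ i ∈ Icc 1 N,
          Function.minimalPeriod T (x i) = 2 ^ (i - 1) ∧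
          Saw.orbit T (x i) ⊆ Saw.G p T k \ Λ ∧
          ¬ Saw.IsStable (Icc 0 (r 0)) T (Saw.orbit T (x i))) ∧
        -- all other points of `G k`
        (∀ y ∈ Saw.G p T k \ (Λ ∪ ⋃ i ∈ Icc 1 N, Saw.orbit T (x i)),
          (∀ i ∈ Icc 2 N, ∀ n : ℕ, T^[n] y ∉ Saw.orbit T (x i)) →
          ∃ n₀ : ℕ, ∀ n ≥ n₀, T^[n] y ∈ Λ)) ∧
      (∀ y ∈ Saw.J p q r T k \ (Saw.G p T k ∪ {Saw.e T q r k}),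
        ∃ n₁ : ℕ, ∀ n ≥ n₁, T^[n] y ∈ Saw.G p T k)) ∧
    -- third case
    ((Saw.alpha p q r k)⁻¹ + (Saw.beta p q r k)⁻¹ < 1 → k + 1 ≤ kstar →
      ∃ Λ : Set ℝ,
        Λ ⊆ Saw.J p q r T k ∧
        Saw.IsCantorSet Λ ∧
        Saw.IsChaotic T Λ ∧
        Saw.ConjugateToShift T Λ ∧
        ∀ x ∈ Saw.J p q r T k \ Λ,
          ∃ n₂ : ℕ, ∀ n ≥ n₂, T^[n] x ∈ Ico 0 (Saw.e T q r k)) := by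
  refine ⟨Saw.attracting_case hseq hT hk, fun hb hab => ?_, Saw.cantor_case hseq hT hstd hk⟩
  obtain ⟨hJ, hGJ, hG, ⟨N, A, B, x, Λ, hc⟩, hin⟩ := Saw.interval_cycle_case hseq hT hk hb hab
  have hmaps : MapsTo T Λ Λ := mapsTo_iff_image_subset.2 hc.chaotic.invariant.subset
  refine ⟨hJ, hGJ, hG, ⟨N, A, B, x, Λ, hc.lt, hc.disjoint, hc.union, hc.subset, hc.chaotic,
    hc.map_succ, hc.map_last, Saw.sigma_bijOn N, hc.order, fun i hi => ?_, fun y hy hav => ?_⟩, hin⟩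
  -- Stability in [0, r_0] would imply stability in the smaller phase space G_k, so instability
  -- passes from G_k to [0, r_0].
  · exact ⟨hc.minimalPeriod i hi, hc.orbit_subset i hi, fun h =>
      hc.unstable i hi (h.mono (Saw.core_subset hseq hT hk hGJ.subset))⟩
  · obtain ⟨n, hn⟩ := hc.absorb y hy.1
      (fun i hi h => hy.2 (Or.inr (mem_biUnion hi h))) hav
    refine ⟨n, fun m hm => ?_⟩
    obtain ⟨d, rfl⟩ := Nat.exists_eq_add_of_le' hm
    rw [Function.iterate_add_apply]
    exact hmaps.iterate d hn
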